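/- Let $p\ge 1$ be an integer and let $d_*=(d_r)_{r\ge 0}$ be a sequence of integers with $d_r\ge 2$ and $d_{p+r}=d_r$ for all $r\ge 0$. For $s\in\{0,1,\dots,p-1\}$ let $T_s$ be the spherically symmetric rooted tree with sequence of branching degrees $(d_s,d_{s+1},d_{s+2},\dots)$, that is, the tree with a root $v_0$ in which every vertex at distance $r$ from $v_0$ has exactly $d_{s+r}$ neighbours at distance $r+1$ from $v_0$. Then the $p$ trees $T_0,\dots,T_{p-1}$ are pairwise cospectral. If moreover $p$ is the smallest period of $d_*$ (that is, the smallest integer $q\ge 1$ with $d_{q+r}=d_r$ for all $r\ge 0$), then $T_0,\dots,T_{p-1}$ are pairwise non-isomorphic as graphs. Here two graphs $G,G'$ of bounded degree are cospectral if their adjacency operators, acting on the complex Hilbert spaces of square-summable functions on the vertices by $(A_G\xi)(u)=\sum_{v:\{u,v\}\in E}\xi(v)$, have the same marked spectrum: they have the same spectrum, equivalent (mutually absolutely continuous) scalar-valued spectral measures, and spectral multiplicity functions which are equal almost everywhere. For a bounded self-adjoint operator $X$ on a separable Hilbert space $\mathcal H$, the local spectral measure at $\xi\in\mathcal H$ is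 the measure $\mu_\xi$ with $\int f\,d\mu_\xi=\langle f(X)\xi\mid\xi\rangle$ for all continuous $f$; a scalar-valued spectral measure for $X$ is a measure $\mu=\mu_\xi$ that dominates every $\mu_\eta$, $\eta\in\mathcal H$; and the spectral multiplicity function of $X$ is the measurable function $\mathfrak m$ from the spectrum of $X$ to $\{1,2,\dots,\infty\}$, unique up to equality $\mu$-almost everywhere, such that $X$ is unitarily equivalent to the operator $\xi(x)\mapsto x\,\xi(x)$ on the Hilbert space of $\mu$-square-integrable functions $\xi$ with values in $\ell^2$ such that at most the first $\mathfrak m(x)$ coordinates of $\xi(x)$ are nonzero. -/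

import Mathlib

open MeasureTheory
open scoped InnerProductSpace CompactlySupported

noncomputable section

namespace SpectralGraph

/-! ### Adjacency operators of graphs of bounded degree -/

/-- The complex Hilbert space of square-summable functions on `V`. -/
abbrev Ell2 (V : Type*) : Type _ := lp (fun _ : V => ℂ) 2

/-- The degrees of the vertices of `G` are uniformly bounded (and finite). -/
def BoundedDegree {V : Type*} (G : SimpleGraph V) : Prop :=
  ∃ D : ℕ, ∀ u, (G.neighborSet u).encard ≤ D

theorem BoundedDegree.finite {V : Type*} {G : SimpleGraph V} (h : BoundedDegree G) (u : V) :
    (G.neighborSet u).Finite := by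
  obtain ⟨D, hD⟩ := h
  exact Set.finite_of_encard_le_coe (hD u)

/-- The finite set of neighbours of `u`. -/
def BoundedDegree.nbrs {V : Type*} {G : SimpleGraph V} (h : BoundedDegree G) (u : V) : Finset V :=
  (h.finite u).toFinset

theorem BoundedDegree.mem_nbrs {V : Type*} {G : SimpleGraph V} (h : BoundedDegree G) {u v : V} :
    v ∈ h.nbrs u ↔ G.Adj u v := by
  simp [BoundedDegree.nbrs]

theorem BoundedDegree.exists_card_le {V : Type*} {G : SimpleGraph V} (h : BoundedDegree G) :
    ∃ D : ℕ, ∀ u, (h.nbrs u).card ≤ D := by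
  obtain ⟨D, hD⟩ := id h
  refine ⟨D, fun u => ?_⟩
  have := hD u
  rw [(h.finite u).encard_eq_coe_toFinset_card] at this
  exact_mod_cast this

/-- The function `u ↦ ∑ v, {u, v} ∈ E, ξ v`. -/
def adjFun {V : Type*} {G : SimpleGraph V} (h : BoundedDegree G) (ξ : V → ℂ) (u : V) : ℂ :=
  ∑ v ∈ h.nbrs u, ξ v

theorem sum_adjFun_le {V : Type*} {G : SimpleGraph V} (h : BoundedDegree G) {D : ℕ}
    (hD : ∀ u, (h.nbrs u).card ≤ D) (ξ : Ell2 V) (s : Finset V) :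
    ∑ u ∈ s, ‖adjFun h ξ u‖ ^ (2 : ENNReal).toReal ≤ ((D : ℝ) * ‖ξ‖) ^ (2 : ENNReal).toReal := by
  classical
  have h2 : (0 : ℝ) < (2 : ENNReal).toReal := by norm_num
  have hle (t : Finset V) : ∑ v ∈ t, ‖ξ v‖ ^ 2 ≤ ‖ξ‖ ^ 2 := by
    have := lp.sum_rpow_le_norm_rpow h2 ξ t
    simpa using this
  have h1 (u : V) : ‖adjFun h ξ u‖ ^ 2 ≤ D * ∑ v ∈ h.nbrs u, ‖ξ v‖ ^ 2 := by
    calc ‖adjFun h ξ u‖ ^ 2 ≤ (∑ v ∈ h.nbrs u, ‖ξ v‖) ^ 2 := by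
          gcongr
          exact norm_sum_le _ _
      _ ≤ (h.nbrs u).card * ∑ v ∈ h.nbrs u, ‖ξ v‖ ^ 2 := sq_sum_le_card_mul_sum_sq
      _ ≤ D * ∑ v ∈ h.nbrs u, ‖ξ v‖ ^ 2 := by
          gcongr
          exact hD u
  have h3 : ∑ u ∈ s, ∑ v ∈ h.nbrs u, ‖ξ v‖ ^ 2 ≤ D * ‖ξ‖ ^ 2 := by
    have hcomm : ∑ u ∈ s, ∑ v ∈ h.nbrs u, ‖ξ v‖ ^ 2
        = ∑ v ∈ s.biUnion h.nbrs, ∑ u ∈ s.filter (fun u => G.Adj v u), ‖ξ v‖ ^ 2 := by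
      refine Finset.sum_comm' ?_
      intro u v
      simp only [Finset.mem_filter, Finset.mem_biUnion, h.mem_nbrs]
      constructor
      · rintro ⟨hu, huv⟩
        exact ⟨⟨hu, huv.symm⟩, u, hu, huv⟩
      · rintro ⟨⟨hu, hvu⟩, -⟩
        exact ⟨hu, hvu.symm⟩
    rw [hcomm]
    calc ∑ v ∈ s.biUnion h.nbrs, ∑ u ∈ s.filter (fun u => G.Adj v u), ‖ξ v‖ ^ 2
        ≤ ∑ v ∈ s.biUnion h.nbrs, D * ‖ξ v‖ ^ 2 := by
          refine Finset.sum_le_sum fun v _ => ?_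
          rw [Finset.sum_const, nsmul_eq_mul]
          gcongr
          refine le_trans (Finset.card_le_card ?_) (hD v)
          intro u hu
          exact h.mem_nbrs.2 (Finset.mem_filter.1 hu).2
      _ = D * ∑ v ∈ s.biUnion h.nbrs, ‖ξ v‖ ^ 2 := by rw [Finset.mul_sum]
      _ ≤ D * ‖ξ‖ ^ 2 := by
          gcongr
          exact hle _
  have h4 : ∑ u ∈ s, ‖adjFun h ξ u‖ ^ 2 ≤ ((D : ℝ) * ‖ξ‖) ^ 2 := by
    calc ∑ u ∈ s, ‖adjFun h ξ u‖ ^ 2 ≤ ∑ u ∈ s, D * ∑ v ∈ h.nbrs u, ‖ξ v‖ ^ 2 :=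
          Finset.sum_le_sum fun u _ => h1 u
      _ = D * ∑ u ∈ s, ∑ v ∈ h.nbrs u, ‖ξ v‖ ^ 2 := by rw [Finset.mul_sum]
      _ ≤ D * (D * ‖ξ‖ ^ 2) := by gcongr
      _ = ((D : ℝ) * ‖ξ‖) ^ 2 := by ring
  simpa using h4

theorem memlp_adjFun {V : Type*} {G : SimpleGraph V} (h : BoundedDegree G) (ξ : Ell2 V) :
    Memℓp (adjFun h ξ) 2 := by
  obtain ⟨D, hD⟩ := h.exists_card_le
  exact memℓp_gen' (sum_adjFun_le h hD ξ)

/-- The adjacency operator of a graph of bounded degree, a bounded operator on `ℓ²(V)`: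
`(A ξ)(u) = ∑ ξ(v)`, the sum being over the neighbours `v` of `u`. -/
def adjacencyOperator {V : Type*} (G : SimpleGraph V) (h : BoundedDegree G) :
    Ell2 V →L[ℂ] Ell2 V :=
  LinearMap.mkContinuousOfExistsBound
    { toFun := fun ξ => ⟨adjFun h ξ, memlp_adjFun h ξ⟩
      map_add' := by
        intro ξ η
        ext u
        change ∑ v ∈ h.nbrs u, (ξ v + η v) = ∑ v ∈ h.nbrs u, ξ v + ∑ v ∈ h.nbrs u, η v
        exact Finset.sum_add_distrib
      map_smul' := by
        intro c ξ
        ext u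
        simp [adjFun, Finset.mul_sum] }
    (by
      obtain ⟨D, hD⟩ := h.exists_card_le
      refine ⟨D, fun ξ => ?_⟩
      refine lp.norm_le_of_forall_sum_le (by norm_num) (by positivity) ?_
      exact sum_adjFun_le h hD ξ)

theorem adjacencyOperator_apply {V : Type*} (G : SimpleGraph V) (h : BoundedDegree G)
    (ξ : Ell2 V) (u : V) : adjacencyOperator G h ξ u = ∑ v ∈ h.nbrs u, ξ v := rfl

/-! ### Scalar-valued spectral measures and spectral multiplicity functions

Throughout, `X` is meant to be a bounded self-adjoint operator on a complex Hilbert space. -/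

section Operators

variable {H : Type*} [NormedAddCommGroup H] [InnerProductSpace ℂ H] [CompleteSpace H]

/-- The positive linear functional `f ↦ ⟨f(X) ξ, ξ⟩` on `C_c(ℝ)`, where `f(X)` is given by the
continuous functional calculus. -/
def spectralFunctional (X : H →L[ℂ] H) (ξ : H) : C_c(ℝ, ℝ) →ₚ[ℝ] ℝ :=
  PositiveLinearMap.mk₀
    { toFun := fun f => (⟪ξ, cfc (fun x : ℝ => f x) X ξ⟫_ℂ).re
      map_add' := by
        intro f g
        have : cfc (fun x : ℝ => (f + g) x) X
            = cfc (fun x : ℝ => f x) X + cfc (fun x : ℝ => g x) X :=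
          cfc_add X (fun x : ℝ => f x) (fun x : ℝ => g x)
            (hf := f.continuous.continuousOn) (hg := g.continuous.continuousOn)
        rw [this]
        simp
      map_smul' := by
        intro c f
        have : cfc (fun x : ℝ => (c • f) x) X = c • cfc (fun x : ℝ => f x) X :=
          cfc_smul c (fun x : ℝ => f x) (hf := f.continuous.continuousOn)
        rw [this]
        simp [← Complex.coe_smul] }
    (by
      intro f hf
      have hpos : (0 : H →L[ℂ] H) ≤ cfc (fun x : ℝ => f x) X :=
        cfc_nonneg fun x _ => hf x
      have := (ContinuousLinearMap.nonneg_iff_isPositive _).1 hpos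
      exact (Complex.le_def.1 (this.inner_nonneg_right ξ)).1)

/-- The local spectral measure of the self-adjoint operator `X` at the vector `ξ`, viewed as a
measure on `ℝ`: the measure `μ` with `∫ f dμ = ⟨f(X) ξ, ξ⟩` for all `f`. -/
def localSpectralMeasure (X : H →L[ℂ] H) (ξ : H) : Measure ℝ :=
  RealRMK.rieszMeasure (spectralFunctional X ξ)

/-- A vector is dominant for `X` if its local spectral measure dominates all local spectral
measures of `X`. -/
def IsDominant (X : H →L[ℂ] H) (ξ : H) : Prop :=
  ∀ η : H, localSpectralMeasure X η ≪ localSpectralMeasure X ξ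

/-- A scalar-valued spectral measure for `X` is the local spectral measure at a dominant vector. -/
def IsScalarSpectralMeasure (X : H →L[ℂ] H) (μ : Measure ℝ) : Prop :=
  ∃ ξ : H, IsDominant X ξ ∧ μ = localSpectralMeasure X ξ

end Operators

/-- The Hilbert space `L²(μ, m)` of square-integrable functions `ξ` on `ℝ` with values in
`ℓ²(ℕ)` such that, for almost every `x`, only the first `m x` coordinates of `ξ x` may be
nonzero (all coordinates if `m x = ⊤`). -/
def multL2 (μ : Measure ℝ) (m : ℝ → ℕ∞) : Submodule ℂ (Lp (Ell2 ℕ) 2 μ) where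
  carrier := {ξ | ∀ᵐ x ∂μ, ∀ j : ℕ, m x ≤ (j : ℕ∞) → ξ x j = 0}
  add_mem' := by
    intro ξ η hξ hη
    filter_upwards [hξ, hη, Lp.coeFn_add ξ η] with x h1 h2 h3 j hj
    rw [h3]
    simp [h1 j hj, h2 j hj]
  zero_mem' := by
    filter_upwards [Lp.coeFn_zero (Ell2 ℕ) 2 μ] with x h j _
    rw [h]
    simp
  smul_mem' := by
    intro c ξ hξ
    filter_upwards [hξ, Lp.coeFn_smul c ξ] with x h1 h2 j hj
    rw [h2]
    simp [h1 j hj]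

/-- `m` (of which only the values on the spectrum of `X` matter) is the spectral multiplicity
function of `X` with respect to the scalar-valued spectral measure `μ`: it is measurable, has
values in `{1, 2, …, ∞}` on the spectrum, and `X` is unitarily equivalent to the straight
multiplication operator `ξ(x) ↦ x ξ(x)` on `L²(μ, m)`. -/
def IsMultiplicityFunction {H : Type*} [NormedAddCommGroup H] [InnerProductSpace ℂ H]
    (X : H →L[ℂ] H) (μ : Measure ℝ) (m : ℝ → ℕ∞) : Prop :=
  Measurable m ∧ (∀ x : ℝ, (x : ℂ) ∈ spectrum ℂ X → 1 ≤ m x) ∧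
    ∃ U : H ≃ₗᵢ[ℂ] multL2 μ m, ∀ ξ : H,
      ((U (X ξ) : Lp (Ell2 ℕ) 2 μ) : ℝ → Ell2 ℕ) =ᵐ[μ]
        fun x => (x : ℂ) • (U ξ : Lp (Ell2 ℕ) 2 μ) x

/-- Two self-adjoint operators have the same marked spectrum: they have the same spectrum,
equivalent scalar-valued spectral measures, and spectral multiplicity functions which are equal
almost everywhere. -/
def SameMarkedSpectrum {H₁ H₂ : Type*} [NormedAddCommGroup H₁] [InnerProductSpace ℂ H₁]
    [CompleteSpace H₁] [NormedAddCommGroup H₂] [InnerProductSpace ℂ H₂] [CompleteSpace H₂]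
    (X₁ : H₁ →L[ℂ] H₁) (X₂ : H₂ →L[ℂ] H₂) : Prop :=
  spectrum ℂ X₁ = spectrum ℂ X₂ ∧
    ∃ (μ₁ μ₂ : Measure ℝ) (m₁ m₂ : ℝ → ℕ∞),
      IsScalarSpectralMeasure X₁ μ₁ ∧ IsScalarSpectralMeasure X₂ μ₂ ∧
      IsMultiplicityFunction X₁ μ₁ m₁ ∧ IsMultiplicityFunction X₂ μ₂ m₂ ∧
      μ₁ ≪ μ₂ ∧ μ₂ ≪ μ₁ ∧ m₁ =ᵐ[μ₁] m₂

/-- Two graphs are cospectral if they are of bounded degree and their adjacency operators have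
the same marked spectrum. -/
def Cospectral {V₁ V₂ : Type*} (G₁ : SimpleGraph V₁) (G₂ : SimpleGraph V₂) : Prop :=
  ∃ (h₁ : BoundedDegree G₁) (h₂ : BoundedDegree G₂),
    SameMarkedSpectrum (adjacencyOperator G₁ h₁) (adjacencyOperator G₂ h₂)

/-! ### Spherically symmetric rooted trees -/

/-- `T` is a tree which, with root `v₀`, is spherically symmetric with sequence of branching
degrees `d`: every vertex at distance `r` from `v₀` has exactly `d r` neighbours at distance
`r + 1` from `v₀`. -/
structure IsSphericallySymmetricTree {V : Type*} (T : SimpleGraph V) (v₀ : V) (d : ℕ → ℕ) :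
    Prop where
  isTree : T.IsTree
  branching : ∀ v : V,
    {w : V | T.Adj v w ∧ T.dist v₀ w = T.dist v₀ v + 1}.encard = d (T.dist v₀ v)

end SpectralGraph

end

/-! Write `A = S + S†`, where `S` is composition with the parent map. `S` raises the distance to the
root by one, and `S†S` acts as the scalar `d r` on functions supported on the sphere of radius `r`.
Call a vector of degree `r` primitive if `S†` kills it. Along the chain `ξ, Sξ, S²ξ, …` of a
primitive `ξ`, the operator `A` is tridiagonal, with coefficients given by the shifted sequence `d
(r + ·)` alone (`inner_orbit`). These chains span a dense subspace, so `ℓ²(V)` is an orthogonal sum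
of cyclic subspaces (`exists_cyclic_decomposition`). Since `d ≥ 2`, differences of siblings give
nonzero primitive vectors in every positive degree, and the root's indicator gives one in degree
zero.

For a sequence of period `p` only `p` cyclic operators occur, and each occurs infinitely often in
every `T_s`. Their measures `ν k` are the local spectral measures at the roots of the `T_k`.
Infinite multiplicity absorbs all differences in how often each occurs: every adjacency operator is
unitarily equivalent to multiplication by `x` on `L²(∑ ν k; ℓ²)`, which does not depend on `s`
(`exists_unitary_multiplication`).

Non-isomorphism is read off from degrees. A vertex other than the root has a parent as well as its
children; comparing degrees `p` levels apart forces an isomorphism to fix the root (`map_root`),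
hence to preserve the branching sequence. Equal shifts would then give a period smaller than `p`. -/

namespace SpectralGraph

/-! ### Moment determinacy on bounded intervals -/

section Moments

/-- The measure `μ` lives on a bounded interval. -/
def BoundedSupport (μ : Measure ℝ) : Prop :=
  ∃ R : ℝ, μ (Set.Icc (-R) R)ᶜ = 0

theorem BoundedSupport.ae_abs_le {μ : Measure ℝ} (h : BoundedSupport μ) :
    ∃ R : ℝ, ∀ᵐ x ∂μ, |x| ≤ R := by
  obtain ⟨R, hR⟩ := h
  refine ⟨R, ?_⟩
  filter_upwards [compl_mem_ae_iff.2 hR] with x hx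
  rw [compl_compl] at hx
  exact abs_le.2 hx

theorem BoundedSupport.of_ae_abs_le {μ : Measure ℝ} {R : ℝ} (h : ∀ᵐ x ∂μ, |x| ≤ R) :
    BoundedSupport μ := by
  refine ⟨R, ?_⟩
  rw [← mem_ae_iff]
  filter_upwards [h] with x hx
  exact abs_le.1 hx

theorem BoundedSupport.add {μ ν : Measure ℝ} (hμ : BoundedSupport μ) (hν : BoundedSupport ν) :
    BoundedSupport (μ + ν) := by
  obtain ⟨R, hR⟩ := hμ.ae_abs_le
  obtain ⟨S, hS⟩ := hν.ae_abs_le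
  refine .of_ae_abs_le (R := max R S) (ae_add_measure_iff.2 ⟨?_, ?_⟩)
  · filter_upwards [hR] with x hx using hx.trans (le_max_left _ _)
  · filter_upwards [hS] with x hx using hx.trans (le_max_right _ _)

theorem BoundedSupport.sum {ι : Type*} {ν : ι → Measure ℝ} (s : Finset ι)
    (hν : ∀ i, BoundedSupport (ν i)) : BoundedSupport (∑ i ∈ s, ν i) := by
  classical
  induction s using Finset.induction_on with
  | empty => exact ⟨0, by simp⟩
  | insert a s ha ih => rw [Finset.sum_insert ha]; exact (hν a).add ih

theorem BoundedSupport.mono {μ ν : Measure ℝ} (hμ : BoundedSupport μ) (h : ν ≪ μ) :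
    BoundedSupport ν := by
  obtain ⟨R, hR⟩ := hμ
  exact ⟨R, h hR⟩

theorem BoundedSupport.integrable_smul {E : Type*} [NormedAddCommGroup E] [NormedSpace ℝ E]
    {μ : Measure ℝ} (h : BoundedSupport μ) {f : ℝ → E} (hf : Integrable f μ) {φ : ℝ → ℝ}
    (hφ : Continuous φ) : Integrable (fun x => φ x • f x) μ := by
  obtain ⟨R, hR⟩ := h.ae_abs_le
  obtain ⟨C, hC⟩ := (isCompact_Icc (a := -R) (b := R)).exists_bound_of_continuousOn hφ.continuousOn
  refine hf.bdd_smul C hφ.aestronglyMeasurable ?_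
  filter_upwards [hR] with x hx
  exact hC x (abs_le.1 hx)

/-- An integrable density on a bounded interval all of whose moments vanish is orthogonal to
all continuous functions. -/
theorem BoundedSupport.integral_smul_eq_zero {E : Type*} [NormedAddCommGroup E] [NormedSpace ℝ E]
    {μ : Measure ℝ} (h : BoundedSupport μ) {f : ℝ → E} (hf : Integrable f μ)
    (h0 : ∀ n : ℕ, ∫ x, x ^ n • f x ∂μ = 0) {φ : ℝ → ℝ} (hφ : Continuous φ) :
    ∫ x, φ x • f x ∂μ = 0 := by
  have hpoly (q : Polynomial ℝ) : ∫ x, q.eval x • f x ∂μ = 0 := by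
    simp_rw [Polynomial.eval_eq_sum_range, Finset.sum_smul, mul_smul]
    rw [integral_finsetSum]
    · refine Finset.sum_eq_zero fun i _ => ?_
      rw [integral_smul, h0, smul_zero]
    · intro i _
      exact (h.integrable_smul hf (continuous_pow i)).smul (q.coeff i)
  obtain ⟨R, hR⟩ := h.ae_abs_le
  rw [← norm_le_zero_iff]
  refine le_of_forall_pos_le_add fun ε hε => ?_
  set I := ∫ x, ‖f x‖ ∂μ with hI
  have hI0 : 0 ≤ I := integral_nonneg fun x => norm_nonneg _
  -- Weierstrass approximation; the `+ 1` keeps the tolerance meaningful when `f` has zero `L¹`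
  -- norm.
  obtain ⟨q, hq⟩ := exists_polynomial_near_of_continuousOn (-R) R φ hφ.continuousOn
    (ε / (I + 1)) (by positivity)
  have hsub : ∫ x, φ x • f x ∂μ = ∫ x, (φ x - q.eval x) • f x ∂μ := by
    simp_rw [sub_smul]
    rw [integral_sub (h.integrable_smul hf hφ) (h.integrable_smul hf q.continuous), hpoly, sub_zero]
  rw [hsub, zero_add]
  calc ‖∫ x, (φ x - q.eval x) • f x ∂μ‖ ≤ ∫ x, ε / (I + 1) * ‖f x‖ ∂μ := by
        refine norm_integral_le_of_norm_le (hf.norm.const_mul _) ?_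
        filter_upwards [hR] with x hx
        rw [norm_smul]
        gcongr
        rw [Real.norm_eq_abs, abs_sub_comm]
        exact (hq x (abs_le.1 hx)).le
    _ = ε * (I / (I + 1)) := by rw [integral_const_mul, ← hI]; ring
    _ ≤ ε * 1 := by
        gcongr
        rw [div_le_one (by positivity)]
        linarith
    _ = ε := mul_one ε

/-- An integrable density on a bounded interval all of whose moments vanish is zero. -/
theorem BoundedSupport.ae_eq_zero_of_moments {E : Type*} [NormedAddCommGroup E] [NormedSpace ℝ E]
    [CompleteSpace E] {μ : Measure ℝ} (h : BoundedSupport μ)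
    {f : ℝ → E} (hf : Integrable f μ) (h0 : ∀ n : ℕ, ∫ x, x ^ n • f x ∂μ = 0) :
    ∀ᵐ x ∂μ, f x = 0 :=
  ae_eq_zero_of_integral_contDiff_smul_eq_zero hf.locallyIntegrable fun _ hg _ =>
    h.integral_smul_eq_zero hf h0 hg.continuous

/-- Finite measures on a bounded interval are determined by their moments. -/
theorem BoundedSupport.ext_of_moments {μ ν : Measure ℝ} [IsFiniteMeasure μ] [IsFiniteMeasure ν]
    (hμ : BoundedSupport μ) (hν : BoundedSupport ν)
    (h : ∀ n : ℕ, ∫ x, x ^ n ∂μ = ∫ x, x ^ n ∂ν) : μ = ν := by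
  have hb := hμ.add hν
  have hμl : μ ≪ μ + ν := (Measure.le_add_right le_rfl).absolutelyContinuous
  have hνl : ν ≪ μ + ν := (Measure.le_add_left le_rfl).absolutelyContinuous
  have hiμ : Integrable (fun x => (μ.rnDeriv (μ + ν) x).toReal) (μ + ν) :=
    Measure.integrable_toReal_rnDeriv
  have hiν : Integrable (fun x => (ν.rnDeriv (μ + ν) x).toReal) (μ + ν) :=
    Measure.integrable_toReal_rnDeriv
  -- The difference of the two densities with respect to `μ + ν` has vanishing moments.
  have h0 := hb.ae_eq_zero_of_moments (hiμ.sub hiν) (by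
    intro n
    have h1 := integral_rnDeriv_smul (f := fun x : ℝ => x ^ n) hμl
    have h2 := integral_rnDeriv_smul (f := fun x : ℝ => x ^ n) hνl
    have e1 := hb.integrable_smul hiμ (continuous_pow n)
    have e2 := hb.integrable_smul hiν (continuous_pow n)
    simp only [smul_eq_mul] at h1 h2 e1 e2
    simp only [Pi.sub_apply, smul_eq_mul, mul_sub]
    rw [integral_sub e1 e2, sub_eq_zero]
    simp_rw [mul_comm ((_ : ℝ) ^ n)]
    rw [h1, h2, h n])
  refine (Measure.withDensity_rnDeriv_eq μ _ hμl).symm.trans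
    (Eq.trans ?_ (Measure.withDensity_rnDeriv_eq ν _ hνl))
  refine withDensity_congr_ae ?_
  filter_upwards [h0, μ.rnDeriv_lt_top (μ + ν), ν.rnDeriv_lt_top (μ + ν)] with x hx h1 h2
  exact (ENNReal.toReal_eq_toReal_iff' h1.ne h2.ne).1 (sub_eq_zero.1 hx)

end Moments

/-! ### Support and moments of local spectral measures -/

section LocalSpectralMeasure

variable {H : Type*} [NormedAddCommGroup H] [InnerProductSpace ℂ H] [CompleteSpace H]

theorem integral_localSpectralMeasure (X : H →L[ℂ] H) (ξ : H) (f : C_c(ℝ, ℝ)) :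
    ∫ x, f x ∂(localSpectralMeasure X ξ) = (⟪ξ, cfc (fun x : ℝ => f x) X ξ⟫_ℂ).re :=
  RealRMK.integral_rieszMeasure _ f

instance regular_localSpectralMeasure (X : H →L[ℂ] H) (ξ : H) :
    (localSpectralMeasure X ξ).Regular := by
  unfold localSpectralMeasure
  infer_instance

theorem exists_spectrum_subset_Icc (X : H →L[ℂ] H) :
    ∃ R : ℝ, spectrum ℝ X ⊆ Set.Icc (-R) R := by
  have hb : Bornology.IsBounded (spectrum ℝ X) := spectrum.isBounded X
  obtain ⟨R, hR⟩ := hb.subset_closedBall 0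
  refine ⟨R, fun x hx => ?_⟩
  have := hR hx
  rwa [Real.closedBall_eq_Icc, zero_sub, zero_add] at this

/-- By inner regularity it suffices to treat compact `K` outside the interval. A bump function equal
to one on `K` and zero on the interval vanishes on the spectrum, so its functional calculus is zero.
-/
theorem localSpectralMeasure_compl_Icc (X : H →L[ℂ] H) (ξ : H) {R : ℝ}
    (hR : spectrum ℝ X ⊆ Set.Icc (-R) R) :
    localSpectralMeasure X ξ (Set.Icc (-R) R)ᶜ = 0 := by
  rw [isClosed_Icc.isOpen_compl.measure_eq_iSup_isCompact]
  simp only [ENNReal.iSup_eq_zero]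
  intro K hK hKc
  obtain ⟨f, hf1, hf0, hfc, hf01⟩ := exists_continuous_one_zero_of_isCompact hKc
    (isClosed_Icc (a := -R) (b := R)) (Set.disjoint_left.2 fun x hx => hK hx)
  have h := RealRMK.rieszMeasure_le_of_eq_one (spectralFunctional X ξ) (f := ⟨f, hfc⟩)
    (fun x => (hf01 x).1) hKc (fun x hx => hf1 hx)
  have hz : spectralFunctional X ξ ⟨f, hfc⟩ = 0 := by
    change (⟪ξ, cfc (fun x : ℝ => f x) X ξ⟫_ℂ).re = 0
    rw [cfc_congr (g := fun _ => (0 : ℝ)) fun x hx => hf0 (hR hx)]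
    simp
  rw [hz, ENNReal.ofReal_zero] at h
  exact le_antisymm h zero_le

theorem boundedSupport_localSpectralMeasure (X : H →L[ℂ] H) (ξ : H) :
    BoundedSupport (localSpectralMeasure X ξ) := by
  obtain ⟨R, hR⟩ := exists_spectrum_subset_Icc X
  exact ⟨R, localSpectralMeasure_compl_Icc X ξ hR⟩

instance isFiniteMeasure_localSpectralMeasure (X : H →L[ℂ] H) (ξ : H) :
    IsFiniteMeasure (localSpectralMeasure X ξ) := by
  obtain ⟨R, hR⟩ := boundedSupport_localSpectralMeasure X ξ
  refine ⟨?_⟩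
  rw [← Set.union_compl_self (Set.Icc (-R) R)]
  refine (measure_union_le _ _).trans_lt ?_
  rw [hR, add_zero]
  exact isCompact_Icc.measure_lt_top

/-- The measure is defined by compactly supported functions only, so `x ^ n` is multiplied by a
cutoff equal to one on an interval that contains the spectrum and carries the measure. -/
theorem moment_localSpectralMeasure {X : H →L[ℂ] H} (hX : IsSelfAdjoint X) (ξ : H) (n : ℕ) :
    ⟪ξ, (X ^ n) ξ⟫_ℂ = ((∫ x, x ^ n ∂(localSpectralMeasure X ξ) : ℝ) : ℂ) := by
  obtain ⟨R, hR⟩ := exists_spectrum_subset_Icc X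
  obtain ⟨f, hf1, -, hfc, -⟩ := exists_continuous_one_zero_of_isCompact
    (isCompact_Icc (a := -R) (b := R)) isClosed_empty (by simp)
  let g : C_c(ℝ, ℝ) := ⟨⟨fun x => x ^ n * f x, by fun_prop⟩, hfc.mul_left⟩
  have h1 : ∫ x, x ^ n ∂(localSpectralMeasure X ξ) = ∫ x, g x ∂(localSpectralMeasure X ξ) := by
    refine integral_congr_ae ?_
    filter_upwards [compl_mem_ae_iff.2 (localSpectralMeasure_compl_Icc X ξ hR)] with x hx
    rw [compl_compl] at hx
    change x ^ n = x ^ n * f x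
    rw [hf1 hx, Pi.one_apply, mul_one]
  have h2 : cfc (fun x : ℝ => g x) X = X ^ n := by
    rw [← cfc_pow_id (R := ℝ) X n]
    refine cfc_congr fun x hx => ?_
    change x ^ n * f x = x ^ n
    rw [hf1 (hR hx), Pi.one_apply, mul_one]
  rw [h1, integral_localSpectralMeasure, h2]
  refine (Complex.conj_eq_iff_re.1 ?_).symm
  rw [inner_conj_symm, ← ContinuousLinearMap.adjoint_inner_right,
    ContinuousLinearMap.isSelfAdjoint_iff'.1 (hX.pow n)]

end LocalSpectralMeasure

/-- Two total families with the same Gram matrix are unitarily equivalent. -/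
theorem exists_linearIsometryEquiv_of_gram {I H K : Type*} [NormedAddCommGroup H]
    [InnerProductSpace ℂ H] [CompleteSpace H] [NormedAddCommGroup K] [InnerProductSpace ℂ K]
    [CompleteSpace K] (v : I → H) (w : I → K)
    (hv : (Submodule.span ℂ (Set.range v)).topologicalClosure = ⊤)
    (hw : (Submodule.span ℂ (Set.range w)).topologicalClosure = ⊤)
    (h : ∀ i j, ⟪w i, w j⟫_ℂ = ⟪v i, v j⟫_ℂ) :
    ∃ U : H ≃ₗᵢ[ℂ] K, ∀ i, U (v i) = w i := by
  have hdv : DenseRange (Finsupp.linearCombination ℂ v) := by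
    rw [DenseRange, ← LinearMap.coe_range, Finsupp.range_linearCombination]
    exact Submodule.dense_iff_topologicalClosure_eq_top.2 hv
  have hdw : DenseRange (Finsupp.linearCombination ℂ w) := by
    rw [DenseRange, ← LinearMap.coe_range, Finsupp.range_linearCombination]
    exact Submodule.dense_iff_topologicalClosure_eq_top.2 hw
  have hn (x : I →₀ ℂ) : ‖Finsupp.linearCombination ℂ w x‖ = ‖Finsupp.linearCombination ℂ v x‖ := by
    have : ⟪Finsupp.linearCombination ℂ w x, Finsupp.linearCombination ℂ w x⟫_ℂ
        = ⟪Finsupp.linearCombination ℂ v x, Finsupp.linearCombination ℂ v x⟫_ℂ := by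
      simp only [Finsupp.linearCombination_apply, Finsupp.sum, sum_inner, inner_sum,
        inner_smul_left, inner_smul_right, h]
    rw [inner_self_eq_norm_sq_to_K, inner_self_eq_norm_sq_to_K] at this
    have h2 : ‖Finsupp.linearCombination ℂ w x‖ ^ 2 = ‖Finsupp.linearCombination ℂ v x‖ ^ 2 := by
      exact_mod_cast this
    exact (pow_left_inj₀ (norm_nonneg _) (norm_nonneg _) two_ne_zero).1 h2
  refine ⟨(LinearEquiv.refl ℂ (I →₀ ℂ)).extendOfIsometry _ _ hdv hdw hn, fun i => ?_⟩
  have := LinearEquiv.extendOfIsometry_eq (LinearEquiv.refl ℂ (I →₀ ℂ)) _ _ hdv hdw hn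
    (Finsupp.single i 1)
  simpa using this

/-! ### Measurable fields of orthogonal vectors with prescribed norms -/

section Fiber

open scoped Classical in
/-- The position of `i` among the indices `j` with `h j x ≠ 0`. -/
noncomputable def fiberIndex (h : ℕ → ℝ → ℝ) (i : ℕ) (x : ℝ) : ℕ :=
  Nat.count (fun j => h j x ≠ 0) i

/-- The vector field with `‖fiberVector h i x‖ ^ 2 = h i x`; for fixed `x`, the vectors with
`h i x ≠ 0` are multiples of distinct basis vectors, without gaps. -/
noncomputable def fiberVector (h : ℕ → ℝ → ℝ) (i : ℕ) (x : ℝ) : Ell2 ℕ :=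
  ((√(h i x) : ℝ) : ℂ) • lp.single 2 (fiberIndex h i x) (1 : ℂ)

variable {h : ℕ → ℝ → ℝ}

theorem measurable_fiberIndex (hm : ∀ i, Measurable (h i)) (i : ℕ) :
    Measurable (fiberIndex h i) := by
  classical
  induction i with
  | zero =>
    have : fiberIndex h 0 = fun _ => 0 := by
      ext x
      simp [fiberIndex]
    rw [this]
    exact measurable_const
  | succ i ih =>
    have : fiberIndex h (i + 1) = fun x => fiberIndex h i x + if h i x ≠ 0 then 1 else 0 := by
      ext x
      simp only [fiberIndex, Nat.count_succ]
    rw [this]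
    refine ih.add (Measurable.ite ?_ measurable_const measurable_const)
    exact (hm i (measurableSet_singleton 0)).compl

theorem stronglyMeasurable_fiberVector (hm : ∀ i, Measurable (h i)) (i : ℕ) :
    StronglyMeasurable (fiberVector h i) := by
  have h1 : StronglyMeasurable fun x => ((√(h i x) : ℝ) : ℂ) :=
    (Complex.measurable_ofReal.comp (hm i).sqrt).stronglyMeasurable
  have h2 : StronglyMeasurable fun n : ℕ => (lp.single 2 n (1 : ℂ) : Ell2 ℕ) :=
    StronglyMeasurable.of_discrete
  exact h1.smul (h2.comp_measurable (measurable_fiberIndex hm i))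

theorem inner_fiberVector_left (i : ℕ) (x : ℝ) (v : Ell2 ℕ) :
    ⟪fiberVector h i x, v⟫_ℂ = (√(h i x) : ℝ) * v (fiberIndex h i x) := by
  rw [fiberVector, inner_smul_left, lp.inner_single_left]
  simp

theorem inner_fiberVector (h0 : ∀ i x, 0 ≤ h i x) (i j : ℕ) (x : ℝ) :
    ⟪fiberVector h i x, fiberVector h j x⟫_ℂ = if i = j then ((h i x : ℝ) : ℂ) else 0 := by
  classical
  rw [inner_fiberVector_left]
  by_cases hij : i = j
  · subst hij
    simp only [fiberVector, lp.coeFn_smul, Pi.smul_apply, lp.single_apply, Pi.single_eq_same,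
      smul_eq_mul, mul_one, if_true]
    rw [← Complex.ofReal_mul, Real.mul_self_sqrt (h0 i x)]
  · rw [if_neg hij]
    by_cases hi : h i x = 0
    · simp [hi]
    by_cases hj : h j x = 0
    · simp [fiberVector, hj]
    have hne : fiberIndex h i x ≠ fiberIndex h j x := fun hc =>
      hij (Nat.count_injective (p := fun k => h k x ≠ 0) hi hj hc)
    rw [fiberVector, lp.coeFn_smul, Pi.smul_apply, lp.single_apply, Pi.single_eq_of_ne hne,
      smul_zero, mul_zero]

/-- Positions are assigned without gaps, so infinitely many nonzero `h i x` use up every coordinate: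
the `j`-th such index sits at coordinate `j`. This is where multiplicity becomes infinite. -/
theorem eq_zero_of_inner_fiberVector (h0 : ∀ i x, 0 ≤ h i x) {x : ℝ}
    (hinf : {i | h i x ≠ 0}.Infinite) {v : Ell2 ℕ} (hv : ∀ i, ⟪fiberVector h i x, v⟫_ℂ = 0) :
    v = 0 := by
  classical
  ext j
  have hP := Nat.nth_mem_of_infinite (p := fun k => h k x ≠ 0) hinf j
  have hc := Nat.count_nth_of_infinite (p := fun k => h k x ≠ 0) hinf j
  have := hv (Nat.nth (fun k => h k x ≠ 0) j)
  rw [inner_fiberVector_left, fiberIndex] at this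
  rw [hc] at this
  rcases mul_eq_zero.1 this with h1 | h1
  · exact absurd (Complex.ofReal_eq_zero.1 h1)
      (Real.sqrt_ne_zero'.2 (lt_of_le_of_ne (h0 _ _) (Ne.symm hP)))
  · simpa using h1

end Fiber

section Multiplication

theorem exists_multiplication_operator {E : Type*} [NormedAddCommGroup E] [NormedSpace ℂ E]
    {μ : Measure ℝ} (hμ : BoundedSupport μ) :
    ∃ M : Lp E 2 μ →L[ℂ] Lp E 2 μ, ∀ F : Lp E 2 μ, M F =ᵐ[μ] fun x => (x : ℂ) • F x := by
  obtain ⟨R, hR⟩ := hμ.ae_abs_le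
  have hx : MemLp (fun x : ℝ => (x : ℂ)) ⊤ μ :=
    memLp_top_of_bound Complex.continuous_ofReal.aestronglyMeasurable R (by simpa using hR)
  refine ⟨(ContinuousLinearMap.lsmul ℂ ℂ).holderL μ ⊤ 2 2 hx.toLp, fun F => ?_⟩
  have h1 := (ContinuousLinearMap.lsmul ℂ ℂ).coeFn_holder (r := 2) hx.toLp F
  rw [ContinuousLinearMap.holderL_apply_apply]
  filter_upwards [h1, hx.coeFn_toLp] with x e1 e2
  rw [e1, e2]
  rfl

end Multiplication

/-! ### The multiplication model -/

section Model

variable {κ : Type*} [Fintype κ] {ν : κ → Measure ℝ}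

/-- A finite real version of the density of `ν k` with respect to the sum of all `ν k`. -/
noncomputable def sumDensity (ν : κ → Measure ℝ) (k : κ) (x : ℝ) : ℝ :=
  ((ν k).rnDeriv (∑ k, ν k) x).toReal

theorem absolutelyContinuous_sum (k : κ) : ν k ≪ ∑ k, ν k :=
  (Measure.le_iff.2 fun s _ => by
    rw [Measure.finsetSum_apply]
    exact Finset.single_le_sum (f := fun k => ν k s) (fun _ _ => zero_le) (Finset.mem_univ k)
    ).absolutelyContinuous

/-- On the set where all densities vanish every `ν k` has mass zero, hence so does their sum. -/
theorem ae_exists_sumDensity_ne_zero [∀ k, IsFiniteMeasure (ν k)] :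
    ∀ᵐ x ∂(∑ k, ν k), ∃ k, sumDensity ν k x ≠ 0 := by
  set μ := ∑ k, ν k with hμ
  have hlt : ∀ᵐ x ∂μ, ∀ k, (ν k).rnDeriv μ x < ⊤ := ae_all_iff.2 fun k => (ν k).rnDeriv_lt_top μ
  have hN : μ {x | ∀ k, (ν k).rnDeriv μ x = 0} = 0 := by
    nth_rw 1 [hμ]
    rw [Measure.finsetSum_apply]
    refine Finset.sum_eq_zero fun k _ => ?_
    rw [← Measure.setLIntegral_rnDeriv (absolutelyContinuous_sum k)]
    have hmeas : MeasurableSet {x | ∀ k, (ν k).rnDeriv μ x = 0} := by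
      rw [Set.ofPred_forall]
      exact MeasurableSet.iInter fun k =>
        Measure.measurable_rnDeriv _ _ (measurableSet_singleton 0)
    rw [setLIntegral_congr_fun (g := fun _ => 0) hmeas fun x hx => hx k]
    simp
  filter_upwards [hlt, measure_eq_zero_iff_ae_notMem.1 hN] with x h1 h2
  rw [not_forall] at h2
  obtain ⟨k, hk⟩ := h2
  exact ⟨k, ENNReal.toReal_ne_zero.2 ⟨hk, (h1 k).ne⟩⟩

/-- A self-adjoint operator which is an orthogonal sum of cyclic operators, with finitely many
local spectral measures `ν k` each of which occurs infinitely often, is unitarily equivalent to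
the multiplication operator on `L²(∑ ν k; ℓ²)`. -/
theorem exists_unitary_multiplication [∀ k, IsFiniteMeasure (ν k)]
    (hb : ∀ k, BoundedSupport (ν k)) {t : ℕ → κ}
    (ht : ∀ k, {i | t i = k}.Infinite) {H : Type*} [NormedAddCommGroup H] [InnerProductSpace ℂ H]
    [CompleteSpace H] (X : H →L[ℂ] H) (ξ : ℕ → H)
    (hgram : ∀ (i j m n : ℕ), ⟪(X ^ m) (ξ i), (X ^ n) (ξ j)⟫_ℂ =
      if i = j then ((∫ x, x ^ (m + n) ∂(ν (t i)) : ℝ) : ℂ) else 0)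
    (hspan : (Submodule.span ℂ (Set.range fun a : ℕ × ℕ =>
      (X ^ a.2) (ξ a.1))).topologicalClosure = ⊤) :
    ∃ U : H ≃ₗᵢ[ℂ] Lp (Ell2 ℕ) 2 (∑ k, ν k), ∀ η : H,
      U (X η) =ᵐ[∑ k, ν k] fun x => (x : ℂ) • U η x := by
  have hbs : BoundedSupport (∑ k, ν k) := BoundedSupport.sum _ hb
  have hac := absolutelyContinuous_sum (ν := ν)
  have hne := ae_exists_sumDensity_ne_zero (ν := ν)
  have hsd : sumDensity ν = fun k x => ((ν k).rnDeriv (∑ k, ν k) x).toReal := rfl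
  generalize hμ : ∑ k, ν k = μ at *
  have hfin : IsFiniteMeasure μ := by
    rw [← hμ]
    infer_instance
  let h : ℕ → ℝ → ℝ := fun i => sumDensity ν (t i)
  have h0 : ∀ i x, 0 ≤ h i x := fun i x => ENNReal.toReal_nonneg
  have hm : ∀ i, Measurable (h i) := fun i => by
    simp only [h, hsd]
    exact (Measure.measurable_rnDeriv _ _).ennreal_toReal
  have hint : ∀ i, Integrable (h i) μ := fun i => by
    simp only [h, hsd]
    exact Measure.integrable_toReal_rnDeriv
  have hmom (i n : ℕ) : ∫ x, x ^ n * h i x ∂μ = ∫ x, x ^ n ∂(ν (t i)) := by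
    simp only [h, hsd]
    rw [← integral_rnDeriv_smul (hac (t i))]
    refine integral_congr_ae (.of_forall fun x => ?_)
    exact mul_comm _ _
  -- The intended image of `X ^ n (ξ i)`: the squared norm of the `i`-th field is the density of `ν
  -- (t i)`, which makes the Gram matrices agree.
  let w0 : ℕ × ℕ → ℝ → Ell2 ℕ := fun a x => ((x : ℂ) ^ a.2) • fiberVector h a.1 x
  have hw0m (a) : StronglyMeasurable (w0 a) :=
    ((Complex.measurable_ofReal.pow_const _).stronglyMeasurable).smul
      (stronglyMeasurable_fiberVector hm a.1)
  have hw0i (a b : ℕ × ℕ) (x : ℝ) : ⟪w0 a x, w0 b x⟫_ℂ =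
      if a.1 = b.1 then ((x ^ (a.2 + b.2) * h a.1 x : ℝ) : ℂ) else 0 := by
    simp only [w0]
    rw [inner_smul_left, inner_smul_right, inner_fiberVector h0]
    split_ifs
    · simp only [map_pow, Complex.conj_ofReal]
      push_cast
      ring
    · simp
  have hw0 (a) : MemLp (w0 a) 2 μ := by
    rw [memLp_two_iff_integrable_sq_norm (hw0m a).aestronglyMeasurable]
    have e (x : ℝ) : ‖w0 a x‖ ^ 2 = x ^ (a.2 + a.2) • h a.1 x := by
      have := hw0i a a x
      rw [if_pos rfl, inner_self_eq_norm_sq_to_K] at this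
      rw [smul_eq_mul]
      refine Complex.ofReal_injective (Eq.trans ?_ this)
      simp
    simp_rw [e]
    exact hbs.integrable_smul (hint a.1) (continuous_pow _)
  let w : ℕ × ℕ → Lp (Ell2 ℕ) 2 μ := fun a => (hw0 a).toLp
  have hwc (a) : w a =ᵐ[μ] w0 a := (hw0 a).coeFn_toLp
  have hgw (a b : ℕ × ℕ) : ⟪w a, w b⟫_ℂ = ⟪(X ^ a.2) (ξ a.1), (X ^ b.2) (ξ b.1)⟫_ℂ := by
    rw [hgram, L2.inner_def]
    have : ∫ x, ⟪w a x, w b x⟫_ℂ ∂μ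
        = ∫ x, if a.1 = b.1 then ((x ^ (a.2 + b.2) * h a.1 x : ℝ) : ℂ) else 0 ∂μ := by
      refine integral_congr_ae ?_
      filter_upwards [hwc a, hwc b] with x e1 e2
      rw [e1, e2, hw0i]
    rw [this]
    split_ifs
    · rw [integral_complex_ofReal, hmom]
    · simp
  -- If `F` is orthogonal to all `w a`, vanishing moments make it pointwise orthogonal to every
  -- field. Almost everywhere some density is nonzero, and its type recurs infinitely often, so `F`
  -- vanishes there.
  have hws : (Submodule.span ℂ (Set.range w)).topologicalClosure = ⊤ := by
    rw [Submodule.topologicalClosure_eq_top_iff, Submodule.eq_bot_iff]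
    intro F hF
    have hF' (a) : ⟪w a, F⟫_ℂ = 0 :=
      Submodule.inner_right_of_mem_orthogonal (Submodule.subset_span (Set.mem_range_self a)) hF
    have hzero (i : ℕ) : ∀ᵐ x ∂μ, ⟪fiberVector h i x, F x⟫_ℂ = 0 := by
      refine hbs.ae_eq_zero_of_moments ?_ ?_
      · refine (L2.integrable_inner (𝕜 := ℂ) (w (i, 0)) F).congr ?_
        filter_upwards [hwc (i, 0)] with x hx
        rw [hx]
        simp [w0]
      · intro n
        rw [← hF' (i, n), L2.inner_def]
        refine integral_congr_ae ?_
        filter_upwards [hwc (i, n)] with x hx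
        rw [hx]
        simp only [w0]
        rw [inner_smul_left, map_pow, Complex.conj_ofReal, Complex.real_smul, Complex.ofReal_pow]
    rw [Lp.eq_zero_iff_ae_eq_zero]
    filter_upwards [ae_all_iff.2 hzero, hne] with x hx ⟨k, hk⟩
    refine eq_zero_of_inner_fiberVector h0 ((ht k).mono ?_) hx
    rintro i rfl
    exact hk
  obtain ⟨U, hU⟩ := exists_linearIsometryEquiv_of_gram _ w hspan hws hgw
  obtain ⟨M, hM⟩ := exists_multiplication_operator (E := Ell2 ℕ) hbs
  have key : (U.toContinuousLinearEquiv : H →L[ℂ] _) ∘L X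
      = M ∘L (U.toContinuousLinearEquiv : H →L[ℂ] _) := by
    refine ContinuousLinearMap.ext_on (Submodule.dense_iff_topologicalClosure_eq_top.2 hspan) ?_
    rintro _ ⟨a, rfl⟩
    change U (X ((X ^ a.2) (ξ a.1))) = M (U ((X ^ a.2) (ξ a.1)))
    have e1 : X ((X ^ a.2) (ξ a.1)) = (X ^ (a.1, a.2 + 1).2) (ξ (a.1, a.2 + 1).1) := by
      rw [pow_succ']
      rfl
    rw [e1, hU (a.1, a.2 + 1), hU a]
    refine Lp.ext ?_
    filter_upwards [hwc (a.1, a.2 + 1), hM (w a), hwc a] with x x1 x2 x3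
    rw [x1, x2, x3]
    simp only [w0]
    rw [smul_smul, pow_succ']
  refine ⟨U, fun η => ?_⟩
  have : U (X η) = M (U η) := DFunLike.congr_fun key η
  rw [this]
  exact hM _

end Model

/-! ### From the model to the marked spectrum -/

section Consequences

variable {H : Type*} [NormedAddCommGroup H] [InnerProductSpace ℂ H]

theorem multL2_top (μ : Measure ℝ) : multL2 μ (fun _ => ⊤) = ⊤ := by
  rw [Submodule.eq_top_iff']
  intro F
  change ∀ᵐ x ∂μ, ∀ j : ℕ, (⊤ : ℕ∞) ≤ (j : ℕ∞) → F x j = 0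
  exact .of_forall fun x j hj => absurd hj (by simp)

theorem isMultiplicityFunction_top {X : H →L[ℂ] H} {μ : Measure ℝ} (U : H ≃ₗᵢ[ℂ] Lp (Ell2 ℕ) 2 μ)
    (hU : ∀ η : H, U (X η) =ᵐ[μ] fun x => (x : ℂ) • U η x) :
    IsMultiplicityFunction X μ (fun _ => ⊤) :=
  ⟨measurable_const, fun _ _ => le_top,
    U.trans (LinearIsometryEquiv.ofTop _ _ (multL2_top μ)).symm, hU⟩

variable [CompleteSpace H]

/-- Both measures live on bounded intervals and have `n`-th moment `⟪η, X ^ n η⟫`. -/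
theorem localSpectralMeasure_eq_withDensity {X : H →L[ℂ] H} (hX : IsSelfAdjoint X) {μ : Measure ℝ}
    (hb : BoundedSupport μ) (U : H ≃ₗᵢ[ℂ] Lp (Ell2 ℕ) 2 μ)
    (hU : ∀ η : H, U (X η) =ᵐ[μ] fun x => (x : ℂ) • U η x) (η : H) :
    localSpectralMeasure X η = μ.withDensity fun x => ENNReal.ofReal (‖U η x‖ ^ 2) := by
  have hi : Integrable (fun x => ‖U η x‖ ^ 2) μ :=
    (memLp_two_iff_integrable_sq_norm (Lp.aestronglyMeasurable _)).1 (Lp.memLp _)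
  have hfin : IsFiniteMeasure (μ.withDensity fun x => ENNReal.ofReal (‖U η x‖ ^ 2)) :=
    isFiniteMeasure_withDensity_ofReal hi.2
  refine (boundedSupport_localSpectralMeasure X η).ext_of_moments
    (hb.mono (withDensity_absolutelyContinuous _ _)) fun n => ?_
  have hpow : U ((X ^ n) η) =ᵐ[μ] fun x => ((x : ℂ) ^ n) • U η x := by
    induction n with
    | zero => simp
    | succ n ih =>
      have e : (X ^ (n + 1)) η = X ((X ^ n) η) := by
        rw [pow_succ']
        rfl
      rw [e]
      filter_upwards [hU ((X ^ n) η), ih] with x h1 h2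
      rw [h1, h2, smul_smul, pow_succ']
  have h1 := moment_localSpectralMeasure hX η n
  rw [← U.inner_map_map, L2.inner_def] at h1
  have h2 : ∫ x, ⟪U η x, U ((X ^ n) η) x⟫_ℂ ∂μ = ((∫ x, ‖U η x‖ ^ 2 * x ^ n ∂μ : ℝ) : ℂ) := by
    rw [← integral_complex_ofReal]
    refine integral_congr_ae ?_
    filter_upwards [hpow] with x hx
    rw [hx, inner_smul_right, inner_self_eq_norm_sq_to_K]
    simp [mul_comm]
  rw [h2] at h1
  rw [← Complex.ofReal_inj.1 h1]
  rw [integral_withDensity_eq_integral_toReal_smul₀]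
  · simp
  · exact hi.aestronglyMeasurable.aemeasurable.ennreal_ofReal
  · exact .of_forall fun _ => ENNReal.ofReal_lt_top

/-- The constant unit field lies in `L²` because `μ` is finite; its local measure is `μ` itself, and
all others have densities with respect to `μ`. -/
theorem isScalarSpectralMeasure_of_unitary {X : H →L[ℂ] H} (hX : IsSelfAdjoint X) {μ : Measure ℝ}
    [IsFiniteMeasure μ] (hb : BoundedSupport μ) (U : H ≃ₗᵢ[ℂ] Lp (Ell2 ℕ) 2 μ)
    (hU : ∀ η : H, U (X η) =ᵐ[μ] fun x => (x : ℂ) • U η x) :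
    IsScalarSpectralMeasure X μ := by
  let e : Lp (Ell2 ℕ) 2 μ := (memLp_const (lp.single 2 0 (1 : ℂ) : Ell2 ℕ)).toLp
  have he : localSpectralMeasure X (U.symm e) = μ := by
    rw [localSpectralMeasure_eq_withDensity hX hb U hU, U.apply_symm_apply]
    conv_rhs => rw [← withDensity_one (μ := μ)]
    refine withDensity_congr_ae ?_
    filter_upwards [(memLp_const (p := 2) (μ := μ) (lp.single 2 0 (1 : ℂ) : Ell2 ℕ)).coeFn_toLp]
      with x hx
    rw [hx, lp.norm_single (by norm_num)]
    simp
  refine ⟨U.symm e, fun η => ?_, he.symm⟩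
  rw [he, localSpectralMeasure_eq_withDensity hX hb U hU]
  exact withDensity_absolutelyContinuous _ _

/-- Operators unitarily equivalent to the same multiplication operator of infinite multiplicity
have the same marked spectrum. -/
theorem sameMarkedSpectrum_of_unitary {H₂ : Type*} [NormedAddCommGroup H₂] [InnerProductSpace ℂ H₂]
    [CompleteSpace H₂] {X : H →L[ℂ] H} {X₂ : H₂ →L[ℂ] H₂} (hX : IsSelfAdjoint X)
    (hX₂ : IsSelfAdjoint X₂) {μ : Measure ℝ} [IsFiniteMeasure μ] (hb : BoundedSupport μ)
    (h : ∃ U : H ≃ₗᵢ[ℂ] Lp (Ell2 ℕ) 2 μ, ∀ η : H, U (X η) =ᵐ[μ] fun x => (x : ℂ) • U η x)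
    (h₂ : ∃ U : H₂ ≃ₗᵢ[ℂ] Lp (Ell2 ℕ) 2 μ, ∀ η : H₂, U (X₂ η) =ᵐ[μ] fun x => (x : ℂ) • U η x) :
    SameMarkedSpectrum X X₂ := by
  obtain ⟨U, hU⟩ := h
  obtain ⟨U₂, hU₂⟩ := h₂
  refine ⟨?_, μ, μ, fun _ => ⊤, fun _ => ⊤, isScalarSpectralMeasure_of_unitary hX hb U hU,
    isScalarSpectralMeasure_of_unitary hX₂ hb U₂ hU₂, isMultiplicityFunction_top U hU,
    isMultiplicityFunction_top U₂ hU₂, .rfl, .rfl, .rfl⟩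
  let W : H ≃L[ℂ] H₂ := (U.trans U₂.symm).toContinuousLinearEquiv
  have hW : W.conjContinuousAlgEquiv X = X₂ := by
    ext η
    change U₂.symm (U (X (U.symm (U₂ η)))) = X₂ η
    rw [LinearIsometryEquiv.symm_apply_eq]
    refine Lp.ext ?_
    filter_upwards [hU (U.symm (U₂ η)), hU₂ η] with x h1 h2
    rw [h1, h2, U.apply_symm_apply]
  rw [← hW]
  exact (AlgEquiv.spectrum_eq W.conjContinuousAlgEquiv X).symm

end Consequences

/-! ### Raising operators and their cyclic decomposition -/

section Raising

/-- The matrix coefficients of the powers of the tridiagonal operator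
`f a ↦ f (a + 1) + c (a - 1) f (a - 1)`, where the `f a` are orthogonal with
`‖f a‖ ^ 2 = c 0 * ⋯ * c (a - 1)`. -/
noncomputable def jacobiMoment (c : ℕ → ℕ) : ℕ → ℕ → ℕ → ℂ
  | 0, a, b => if a = b then ∏ k ∈ Finset.range a, (c k : ℂ) else 0
  | m + 1, a, b => jacobiMoment c m (a + 1) b +
      if a = 0 then 0 else (c (a - 1) : ℂ) * jacobiMoment c m (a - 1) b

variable {H : Type*} [NormedAddCommGroup H] [InnerProductSpace ℂ H]

theorem pow_succ_apply (S : H →L[ℂ] H) (n : ℕ) (ξ : H) : (S ^ (n + 1)) ξ = S ((S ^ n) ξ) := by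
  rw [pow_succ']
  rfl

theorem pow_succ_apply' (S : H →L[ℂ] H) (n : ℕ) (ξ : H) : (S ^ (n + 1)) ξ = (S ^ n) (S ξ) := by
  rw [pow_succ]
  rfl

variable [CompleteSpace H]

/-- A grading of a Hilbert space by finite-dimensional subspaces `E r`, together with a raising
operator `S` which multiplies norms of vectors in `E r` by the square root of `c r`, and which is
not surjective in any degree. -/
structure IsRaisingOperator (S : H →L[ℂ] H) (E : ℕ → Submodule ℂ H) (c : ℕ → ℕ) : Prop where
  finite : ∀ r, Module.Finite ℂ (E r)
  orthogonal : ∀ r s, r ≠ s → ∀ ξ ∈ E r, ∀ η ∈ E s, ⟪ξ, η⟫_ℂ = 0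
  total : (⨆ r, E r).topologicalClosure = ⊤
  map_mem : ∀ r, ∀ ξ ∈ E r, S ξ ∈ E (r + 1)
  adjoint_mem : ∀ r, ∀ ξ ∈ E (r + 1), S.adjoint ξ ∈ E r
  adjoint_zero : ∀ ξ ∈ E 0, S.adjoint ξ = 0
  adjoint_map : ∀ r, ∀ ξ ∈ E r, S.adjoint (S ξ) = (c r : ℂ) • ξ
  ne_zero : ∀ r, c r ≠ 0
  exists_primitive : ∀ r, ∃ ξ ∈ E r, ξ ≠ 0 ∧ S.adjoint ξ = 0

/-- The vectors of degree `r` killed by the lowering operator. -/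
noncomputable def primitive (S : H →L[ℂ] H) (E : ℕ → Submodule ℂ H) (r : ℕ) : Submodule ℂ H :=
  E r ⊓ LinearMap.ker S.adjoint.toLinearMap

theorem mem_primitive {S : H →L[ℂ] H} {E : ℕ → Submodule ℂ H} {r : ℕ} {ξ : H} :
    ξ ∈ primitive S E r ↔ ξ ∈ E r ∧ S.adjoint ξ = 0 :=
  Iff.rfl

theorem isSelfAdjoint_add_adjoint (S : H →L[ℂ] H) : IsSelfAdjoint (S + S.adjoint) := by
  rw [ContinuousLinearMap.isSelfAdjoint_iff', map_add, ContinuousLinearMap.adjoint_adjoint,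
    add_comm]

theorem inner_pow_pow {X : H →L[ℂ] H} (hX : IsSelfAdjoint X) (m n : ℕ) (ξ η : H) :
    ⟪(X ^ m) ξ, (X ^ n) η⟫_ℂ = ⟪(X ^ (m + n)) ξ, η⟫_ℂ := by
  rw [add_comm, pow_add, mul_apply_eq_comp, ← ContinuousLinearMap.adjoint_inner_left,
    ContinuousLinearMap.isSelfAdjoint_iff'.1 (hX.pow n)]

namespace IsRaisingOperator

variable {S : H →L[ℂ] H} {E : ℕ → Submodule ℂ H} {c : ℕ → ℕ}

theorem pow_mem (h : IsRaisingOperator S E c) {r : ℕ} {ξ : H} (hξ : ξ ∈ E r) (n : ℕ) :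
    (S ^ n) ξ ∈ E (r + n) := by
  induction n with
  | zero => exact hξ
  | succ n ih =>
    rw [pow_succ_apply]
    exact h.map_mem _ _ ih

theorem adjoint_pow_succ (h : IsRaisingOperator S E c) {r : ℕ} {ξ : H} (hξ : ξ ∈ E r) (n : ℕ) :
    S.adjoint ((S ^ (n + 1)) ξ) = (c (r + n) : ℂ) • (S ^ n) ξ := by
  rw [pow_succ_apply, h.adjoint_map _ _ (h.pow_mem hξ n)]

theorem add_adjoint_pow (h : IsRaisingOperator S E c) {r : ℕ} {ξ : H}
    (hξ : ξ ∈ primitive S E r) (n : ℕ) :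
    (S + S.adjoint) ((S ^ n) ξ) = (S ^ (n + 1)) ξ +
      if n = 0 then 0 else (c (r + (n - 1)) : ℂ) • (S ^ (n - 1)) ξ := by
  rw [add_apply, ← pow_succ_apply]
  congr 1
  cases n with
  | zero => exact (mem_primitive.1 hξ).2
  | succ n => exact h.adjoint_pow_succ (mem_primitive.1 hξ).1 n

/-- Moving one `S` across the inner product cancels a factor on each side and leaves a scalar;
unequal exponents end with `S†` applied to a primitive vector. Only the level of `ξ` enters the
coefficients. -/
theorem inner_pow_pow_primitive (h : IsRaisingOperator S E c) {r s : ℕ} {ξ η : H}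
    (hξ : ξ ∈ primitive S E r) (hη : η ∈ primitive S E s) (a b : ℕ) :
    ⟪(S ^ a) ξ, (S ^ b) η⟫_ℂ =
      (if a = b then ∏ k ∈ Finset.range a, (c (r + k) : ℂ) else 0) * ⟪ξ, η⟫_ℂ := by
  induction a generalizing b with
  | zero =>
    cases b with
    | zero => simp
    | succ b =>
      rw [pow_succ_apply, ← ContinuousLinearMap.adjoint_inner_left, pow_zero,
        one_apply_eq_self, (mem_primitive.1 hξ).2]
      simp
  | succ a ih =>
    cases b with
    | zero =>
      rw [pow_succ_apply, ← ContinuousLinearMap.adjoint_inner_right, pow_zero,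
        one_apply_eq_self, (mem_primitive.1 hη).2]
      simp
    | succ b =>
      rw [pow_succ_apply S b, ← ContinuousLinearMap.adjoint_inner_left,
        h.adjoint_pow_succ (mem_primitive.1 hξ).1, inner_smul_left, ih, map_natCast]
      simp only [add_left_inj, Finset.prod_range_succ]
      split_ifs
      · ring
      · simp

/-- The recursion of `jacobiMoment` copies the action of `S + S†` on a chain, so the moments see
only the shifted coefficients. -/
theorem inner_pow_add_adjoint (h : IsRaisingOperator S E c) {r s : ℕ} {ξ η : H}
    (hξ : ξ ∈ primitive S E r) (hη : η ∈ primitive S E s) (m a b : ℕ) :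
    ⟪((S + S.adjoint) ^ m) ((S ^ a) ξ), (S ^ b) η⟫_ℂ =
      jacobiMoment (fun k => c (r + k)) m a b * ⟪ξ, η⟫_ℂ := by
  induction m generalizing a with
  | zero => exact h.inner_pow_pow_primitive hξ hη a b
  | succ m ih =>
    rw [pow_succ_apply', h.add_adjoint_pow hξ, map_add, inner_add_left, ih, jacobiMoment, add_mul]
    congr 1
    split_ifs
    · rw [map_zero, inner_zero_left, zero_mul]
    · rw [map_smul, inner_smul_left, ih, map_natCast, mul_assoc]

theorem inner_orbit (h : IsRaisingOperator S E c) {r s : ℕ} {ξ η : H}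
    (hξ : ξ ∈ primitive S E r) (hη : η ∈ primitive S E s) (m n : ℕ) :
    ⟪((S + S.adjoint) ^ m) ξ, ((S + S.adjoint) ^ n) η⟫_ℂ =
      jacobiMoment (fun k => c (r + k)) (m + n) 0 0 * ⟪ξ, η⟫_ℂ := by
  rw [inner_pow_pow (isSelfAdjoint_add_adjoint S)]
  exact h.inner_pow_add_adjoint hξ hη (m + n) 0 0

/-- A subspace invariant under `S + S†` and containing all primitive vectors is dense. -/
theorem topologicalClosure_eq_top (h : IsRaisingOperator S E c) {W : Submodule ℂ H}
    (hW : ∀ ξ ∈ W, (S + S.adjoint) ξ ∈ W) (hp : ∀ r, primitive S E r ≤ W) :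
    W.topologicalClosure = ⊤ := by
  -- Solve the three-term relation for `S ^ (n + 1) ξ`: it is `(S + S†)(S ^ n ξ)` minus a multiple
  -- of `S ^ (n - 1) ξ`.
  have hpow (n r : ℕ) (ξ : H) (hξ : ξ ∈ primitive S E r) : (S ^ n) ξ ∈ W := by
    induction n using Nat.strong_induction_on with
    | _ n ih =>
      cases n with
      | zero => exact hp r hξ
      | succ n =>
        rw [← add_sub_cancel_right ((S ^ (n + 1)) ξ)
          (if n = 0 then 0 else (c (r + (n - 1)) : ℂ) • (S ^ (n - 1)) ξ), ← h.add_adjoint_pow hξ]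
        refine W.sub_mem (hW _ (ih n (Nat.lt_succ_self n))) ?_
        split_ifs
        · exact W.zero_mem
        · exact W.smul_mem _ (ih _ (by omega))
  let D : Submodule ℂ H := Submodule.span ℂ {η | ∃ n r, ∃ ξ ∈ primitive S E r, η = (S ^ n) ξ}
  have hDW : D ≤ W := by
    refine Submodule.span_le.2 ?_
    rintro _ ⟨n, r, ξ, hξ, rfl⟩
    exact hpow n r ξ hξ
  have hSD : D ≤ D.comap S.toLinearMap := by
    refine Submodule.span_le.2 ?_
    rintro _ ⟨n, r, ξ, hξ, rfl⟩
    exact Submodule.subset_span ⟨n + 1, r, ξ, hξ, (pow_succ_apply S n ξ).symm⟩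
  have hpD (r : ℕ) : primitive S E r ≤ D := fun ξ hξ => Submodule.subset_span ⟨0, r, ξ, hξ, rfl⟩
  have hED (r : ℕ) : E r ≤ D := by
    induction r with
    | zero => exact fun ξ hξ => hpD 0 ⟨hξ, h.adjoint_zero ξ hξ⟩
    | succ r ih =>
      intro ξ hξ
      have hc : (c r : ℂ) ≠ 0 := Nat.cast_ne_zero.2 (h.ne_zero r)
      have h1 := h.adjoint_mem r ξ hξ
      -- Chosen so that `ξ - S η` is primitive: degree `r + 1` is the image of degree `r` plus the
      -- primitive vectors.
      set η := (c r : ℂ)⁻¹ • S.adjoint ξ with hη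
      have hηE : η ∈ E r := (E r).smul_mem _ h1
      rw [← add_sub_cancel (S η) ξ]
      refine D.add_mem (hSD (ih hηE)) (hpD (r + 1) ⟨(E _).sub_mem hξ (h.map_mem r η hηE), ?_⟩)
      change S.adjoint (ξ - S η) = 0
      rw [map_sub, h.adjoint_map r η hηE, hη, smul_inv_smul₀ hc, sub_self]
  rw [eq_top_iff, ← h.total]
  exact Submodule.topologicalClosure_mono ((iSup_le hED).trans hDW)

/-- Orthonormal bases of the primitive spaces of all levels together generate the cyclic summands.
Finite dimension makes this family countable, and a nonzero primitive vector at each level makes it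
infinite and `lev` surjective. -/
theorem exists_cyclic_decomposition (h : IsRaisingOperator S E c) :
    ∃ (ξ : ℕ → H) (lev : ℕ → ℕ), Function.Surjective lev ∧
      (∀ i j m n : ℕ, ⟪((S + S.adjoint) ^ m) (ξ i), ((S + S.adjoint) ^ n) (ξ j)⟫_ℂ =
        if i = j then jacobiMoment (fun k => c (lev i + k)) (m + n) 0 0 else 0) ∧
      (Submodule.span ℂ (Set.range fun a : ℕ × ℕ =>
        ((S + S.adjoint) ^ a.2) (ξ a.1))).topologicalClosure = ⊤ := by
  have hfin (r : ℕ) : FiniteDimensional ℂ (primitive S E r) :=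
    have := h.finite r
    Submodule.finiteDimensional_of_le inf_le_left
  let b (r : ℕ) := stdOrthonormalBasis ℂ (primitive S E r)
  let ι := Σ r : ℕ, Fin (Module.finrank ℂ (primitive S E r))
  have hpos (r : ℕ) : 0 < Module.finrank ℂ (primitive S E r) := by
    obtain ⟨ξ, hξ, hne, h0⟩ := h.exists_primitive r
    exact Module.finrank_pos_iff_exists_ne_zero.2
      ⟨⟨ξ, hξ, h0⟩, fun hc => hne (congrArg Subtype.val hc)⟩
  have hsurj : Function.Surjective (Sigma.fst : ι → ℕ) := fun r => ⟨⟨r, ⟨0, hpos r⟩⟩, rfl⟩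
  have : Infinite ι := Infinite.of_surjective _ hsurj
  obtain ⟨e⟩ : Nonempty (ℕ ≃ ι) := (nonempty_equiv_of_countable)
  let v : ι → H := fun i => (b i.1 i.2 : H)
  have hv (i : ι) : v i ∈ primitive S E i.1 := (b i.1 i.2).2
  have hvo (i j : ι) : ⟪v i, v j⟫_ℂ = if i = j then 1 else 0 := by
    obtain ⟨r, i⟩ := i
    obtain ⟨s, j⟩ := j
    by_cases hrs : r = s
    · subst hrs
      have := orthonormal_iff_ite.1 (b r).orthonormal i j
      refine Eq.trans this ?_
      by_cases hij : i = j
      · rw [hij, if_pos rfl, if_pos rfl]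
      · refine (if_neg hij).trans (if_neg fun hc => hij ?_).symm
        exact eq_of_heq (Sigma.mk.inj hc).2
    · rw [h.orthogonal r s hrs _ (mem_primitive.1 (hv ⟨r, i⟩)).1 _
        (mem_primitive.1 (hv ⟨s, j⟩)).1, if_neg]
      exact fun hc => hrs (congrArg Sigma.fst hc)
  refine ⟨v ∘ e, Sigma.fst ∘ e, hsurj.comp e.surjective, fun i j m n => ?_, ?_⟩
  · rw [Function.comp_apply, Function.comp_apply, h.inner_orbit (hv _) (hv _), hvo]
    simp
  · refine h.topologicalClosure_eq_top ?_ fun r => ?_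
    · intro ξ hξ
      refine (Submodule.span_le (p := (Submodule.span ℂ _).comap
        (S + S.adjoint).toLinearMap)).2 ?_ hξ
      rintro _ ⟨a, rfl⟩
      exact Submodule.subset_span ⟨(a.1, a.2 + 1), pow_succ_apply _ _ _⟩
    · intro ξ hξ
      have := (b r).sum_repr ⟨ξ, hξ⟩
      have h2 : ξ = ∑ i, (b r).repr ⟨ξ, hξ⟩ i • v ⟨r, i⟩ := by
        conv_lhs => rw [← Subtype.coe_mk (p := fun x => x ∈ primitive S E r) ξ hξ, ← this]
        simp [v]
      rw [h2]
      refine Submodule.sum_mem _ fun i _ => Submodule.smul_mem _ _ (Submodule.subset_span ?_)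
      exact ⟨(e.symm ⟨r, i⟩, 0), by simp⟩

end IsRaisingOperator

end Raising

/-! ### Adjacency operators restricted to directed edges -/

section Directed

variable {V : Type*} {G : SimpleGraph V}

open scoped Classical in
/-- The sum of `ξ` over those neighbours `v` of `u` with `R u v`. -/
noncomputable def directedFun (h : BoundedDegree G) (R : V → V → Prop) (ξ : V → ℂ) (u : V) : ℂ :=
  ∑ v ∈ (h.nbrs u).filter (R u), ξ v

/-- A partial sum over neighbours is dominated by the full adjacency sum of `‖ξ‖`, which has the
same `ℓ²` norm as `ξ`. -/
theorem sum_directedFun_le (h : BoundedDegree G) (R : V → V → Prop) {D : ℕ}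
    (hD : ∀ u, (h.nbrs u).card ≤ D) (ξ : Ell2 V) (s : Finset V) :
    ∑ u ∈ s, ‖directedFun h R ξ u‖ ^ (2 : ENNReal).toReal
      ≤ ((D : ℝ) * ‖ξ‖) ^ (2 : ENNReal).toReal := by
  classical
  have hmem : Memℓp (fun v => ((‖ξ v‖ : ℝ) : ℂ)) 2 := by
    have := lp.memℓp ξ
    rw [memℓp_gen_iff (by norm_num)] at this ⊢
    simpa using this
  let ζ : Ell2 V := ⟨_, hmem⟩
  have hζ : ‖ζ‖ = ‖ξ‖ := by
    rw [lp.norm_eq_tsum_rpow (by norm_num), lp.norm_eq_tsum_rpow (by norm_num)]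
    simp [ζ]
  rw [← hζ]
  refine le_trans (Finset.sum_le_sum fun u _ => ?_) (sum_adjFun_le h hD ζ s)
  have hle : ‖directedFun h R ξ u‖ ≤ ‖adjFun h ζ u‖ := by
    have e : adjFun h ζ u = ((∑ v ∈ h.nbrs u, ‖ξ v‖ : ℝ) : ℂ) := by
      rw [Complex.ofReal_sum]
      rfl
    rw [e, Complex.norm_real, Real.norm_of_nonneg (Finset.sum_nonneg fun _ _ => norm_nonneg _)]
    refine (norm_sum_le _ _).trans ?_
    exact Finset.sum_le_sum_of_subset_of_nonneg (Finset.filter_subset _ _)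
      fun _ _ _ => norm_nonneg _
  exact Real.rpow_le_rpow (norm_nonneg _) hle (by norm_num)

/-- The adjacency operator restricted to the edges `(u, v)` with `R u v`. -/
noncomputable def directedOperator (h : BoundedDegree G) (R : V → V → Prop) :
    Ell2 V →L[ℂ] Ell2 V :=
  LinearMap.mkContinuousOfExistsBound
    { toFun := fun ξ => ⟨directedFun h R ξ, by
        obtain ⟨D, hD⟩ := h.exists_card_le
        exact memℓp_gen' (sum_directedFun_le h R hD ξ)⟩
      map_add' := by
        intro ξ η
        ext u
        exact Finset.sum_add_distrib
      map_smul' := by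
        intro c ξ
        ext u
        simp [directedFun, Finset.mul_sum] }
    (by
      obtain ⟨D, hD⟩ := h.exists_card_le
      refine ⟨D, fun ξ => ?_⟩
      refine lp.norm_le_of_forall_sum_le (by norm_num) (by positivity) ?_
      exact sum_directedFun_le h R hD ξ)

open scoped Classical in
theorem directedOperator_apply (h : BoundedDegree G) (R : V → V → Prop) (ξ : Ell2 V) (u : V) :
    directedOperator h R ξ u = ∑ v ∈ (h.nbrs u).filter (R u), ξ v := rfl

open scoped Classical in
/-- The indicator function of a vertex. -/
noncomputable def dirac (v : V) : Ell2 V := lp.single 2 v (1 : ℂ)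

theorem dirac_same (v : V) : dirac v v = 1 := by
  classical
  rw [dirac, lp.single_apply, Pi.single_eq_same]

theorem dirac_of_ne {u v : V} (h : u ≠ v) : dirac v u = 0 := by
  classical
  rw [dirac, lp.single_apply, Pi.single_eq_of_ne h]

theorem inner_dirac_left (v : V) (ξ : Ell2 V) : ⟪dirac v, ξ⟫_ℂ = ξ v := by
  classical
  rw [dirac, lp.inner_single_left]
  simp

open scoped Classical in
theorem directedOperator_dirac_apply (h : BoundedDegree G) (R : V → V → Prop) (u v : V) :
    directedOperator h R (dirac v) u = if G.Adj u v ∧ R u v then 1 else 0 := by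
  rw [directedOperator_apply]
  split_ifs with huv
  · rw [Finset.sum_eq_single v, dirac_same]
    · exact fun w _ hw => dirac_of_ne hw
    · intro hv
      exact absurd (Finset.mem_filter.2 ⟨h.mem_nbrs.2 huv.1, huv.2⟩) hv
  · refine Finset.sum_eq_zero fun w hw => dirac_of_ne ?_
    rintro rfl
    rw [Finset.mem_filter, h.mem_nbrs] at hw
    exact huv hw

theorem adjoint_directedOperator (h : BoundedDegree G) (R : V → V → Prop) :
    (directedOperator h R).adjoint = directedOperator h (fun u v => R v u) := by
  classical
  ext η v
  rw [← inner_dirac_left, ContinuousLinearMap.adjoint_inner_right, directedOperator_apply]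
  have : directedOperator h R (dirac v) = ∑ u ∈ (h.nbrs v).filter (fun u => R u v), dirac u := by
    ext u
    rw [directedOperator_dirac_apply, lp.coeFn_sum, Finset.sum_apply]
    split_ifs with huv
    · rw [Finset.sum_eq_single u, dirac_same]
      · exact fun w _ hw => dirac_of_ne hw.symm
      · intro hu
        exact absurd (Finset.mem_filter.2 ⟨h.mem_nbrs.2 huv.1.symm, huv.2⟩) hu
    · refine (Finset.sum_eq_zero fun w hw => dirac_of_ne ?_).symm
      rintro rfl
      rw [Finset.mem_filter, h.mem_nbrs] at hw
      exact huv ⟨hw.1.symm, hw.2⟩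
  rw [this, sum_inner]
  exact Finset.sum_congr rfl fun u _ => inner_dirac_left u η

end Directed

/-! ### Geometry of the trees and their raising operators -/

namespace IsSphericallySymmetricTree

variable {V : Type*} {T : SimpleGraph V} {v₀ : V} {d : ℕ → ℕ}

/-- The set of neighbours of `v` which are farther from the root. -/
def children (T : SimpleGraph V) (v₀ v : V) : Set V :=
  {w | T.Adj v w ∧ T.dist v₀ w = T.dist v₀ v + 1}

/-- Geodesics from the root to `w₁` and `w₂`, each extended by the edge to `v`, are paths; a tree
has only one, and the parent is its penultimate vertex. -/
theorem parent_unique (hT : T.IsTree) {v w₁ w₂ : V} (h₁ : v ∈ children T v₀ w₁)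
    (h₂ : v ∈ children T v₀ w₂) : w₁ = w₂ := by
  obtain ⟨p₁, hp₁⟩ := hT.connected.exists_walk_length_eq_dist v₀ w₁
  obtain ⟨p₂, hp₂⟩ := hT.connected.exists_walk_length_eq_dist v₀ w₂
  have q₁ : (p₁.concat h₁.1).IsPath :=
    SimpleGraph.Walk.isPath_of_length_eq_dist _ (by rw [SimpleGraph.Walk.length_concat, hp₁, h₁.2])
  have q₂ : (p₂.concat h₂.1).IsPath :=
    SimpleGraph.Walk.isPath_of_length_eq_dist _ (by rw [SimpleGraph.Walk.length_concat, hp₂, h₂.2])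
  have := congrArg SimpleGraph.Walk.penultimate ((hT.existsUnique_path v₀ v).unique q₁ q₂)
  simpa using this

theorem neighborSet_root (v₀ : V) : T.neighborSet v₀ = children T v₀ v₀ := by
  ext w
  refine ⟨fun hw => ⟨hw, ?_⟩, fun hw => hw.1⟩
  rw [SimpleGraph.dist_self, zero_add]
  exact SimpleGraph.dist_eq_one_iff_adj.2 hw

theorem exists_parent (hT : T.IsTree) {v : V} (hv : v ≠ v₀) : ∃ w, v ∈ children T v₀ w := by
  obtain ⟨p, hp⟩ := hT.connected.exists_walk_length_eq_dist v₀ v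
  have hnil : ¬ p.Nil := fun hn => hv hn.eq.symm
  have hadj := p.adj_penultimate hnil
  refine ⟨p.penultimate, hadj, ?_⟩
  rcases hT.dist_eq_dist_add_one_of_adj v₀ hadj with h | h
  · have h1 := SimpleGraph.dist_le p.dropLast
    have h2 := p.length_dropLast_add_one hnil
    omega
  · exact h

theorem neighborSet_of_mem_children (hT : T.IsTree) {v w : V} (hv : v ∈ children T v₀ w) :
    T.neighborSet v = insert w (children T v₀ v) := by
  ext u
  rw [Set.mem_insert_iff, SimpleGraph.mem_neighborSet]
  constructor
  · intro hu
    rcases hT.dist_eq_dist_add_one_of_adj v₀ hu with h | h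
    · exact Or.inl (parent_unique hT ⟨hu.symm, h⟩ hv)
    · exact Or.inr ⟨hu, h⟩
  · rintro (rfl | hu)
    · exact hv.1.symm
    · exact hu.1

theorem notMem_children_of_mem {v w : V} (hv : v ∈ children T v₀ w) : w ∉ children T v₀ v := by
  intro hw
  have h1 := hv.2
  have h2 := hw.2
  omega

theorem encard_children (hT : IsSphericallySymmetricTree T v₀ d) (v : V) :
    (children T v₀ v).encard = d (T.dist v₀ v) :=
  hT.branching v

theorem encard_neighborSet_root (hT : IsSphericallySymmetricTree T v₀ d) :
    (T.neighborSet v₀).encard = d 0 := by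
  rw [neighborSet_root v₀, hT.encard_children, SimpleGraph.dist_self]

theorem encard_neighborSet (hT : IsSphericallySymmetricTree T v₀ d) {v : V} (hv : v ≠ v₀) :
    (T.neighborSet v).encard = d (T.dist v₀ v) + 1 := by
  obtain ⟨w, hw⟩ := exists_parent hT.isTree hv
  rw [neighborSet_of_mem_children hT.isTree hw,
    Set.encard_insert_of_notMem (notMem_children_of_mem hw), hT.encard_children]

theorem boundedDegree (hT : IsSphericallySymmetricTree T v₀ d) {D : ℕ} (hD : ∀ r, d r ≤ D) :
    BoundedDegree T := by
  refine ⟨D + 1, fun v => ?_⟩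
  by_cases hv : v = v₀
  · rw [hv, hT.encard_neighborSet_root]
    exact_mod_cast (hD 0).trans (Nat.le_succ D)
  · rw [hT.encard_neighborSet hv]
    exact_mod_cast Nat.succ_le_succ (hD _)

theorem children_nonempty (hT : IsSphericallySymmetricTree T v₀ d) (hd : ∀ r, 2 ≤ d r) (v : V) :
    ∃ a ∈ children T v₀ v, ∃ b ∈ children T v₀ v, a ≠ b := by
  have h : 1 < (children T v₀ v).encard := by
    rw [hT.encard_children]
    exact_mod_cast hd _
  obtain ⟨a, b, ha, hb, hab⟩ := Set.one_lt_encard_iff.1 h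
  exact ⟨a, ha, b, hb, hab⟩

/-- Every vertex has descendants at every distance. -/
theorem exists_descendant (hT : IsSphericallySymmetricTree T v₀ d) (hd : ∀ r, 2 ≤ d r) (v : V)
    (n : ℕ) : ∃ w, T.dist v₀ w = T.dist v₀ v + n ∧ T.dist v w = n := by
  induction n with
  | zero => exact ⟨v, rfl, SimpleGraph.dist_self⟩
  | succ n ih =>
    obtain ⟨w, h1, h2⟩ := ih
    obtain ⟨a, ha, -⟩ := hT.children_nonempty hd w
    refine ⟨a, by rw [ha.2, h1, add_assoc], ?_⟩
    -- The path through `w` bounds the distance from `v` to `a` above; the distances to the root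
    -- bound it below.
    have h3 := hT.isTree.connected.dist_triangle (u := v) (v := w) (w := a)
    have h4 := hT.isTree.connected.dist_triangle (u := v₀) (v := v) (w := a)
    have h5 := SimpleGraph.dist_eq_one_iff_adj.2 ha.1
    have h6 := ha.2
    omega

theorem finite_sphere (hT : IsSphericallySymmetricTree T v₀ d) (r : ℕ) :
    {v | T.dist v₀ v = r}.Finite := by
  induction r with
  | zero =>
    refine (Set.finite_singleton v₀).subset fun v hv => ?_
    exact (hT.isTree.connected.dist_eq_zero_iff.1 hv).symm
  | succ r ih =>
    refine (ih.biUnion (t := children T v₀) fun v _ => ?_).subset ?_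
    · exact Set.finite_of_encard_eq_coe (hT.encard_children v)
    · intro v hv
      have hne : v ≠ v₀ := by
        rintro rfl
        have h0 : T.dist v v = r + 1 := hv
        rw [SimpleGraph.dist_self] at h0
        omega
      obtain ⟨w, hw⟩ := exists_parent hT.isTree hne
      refine Set.mem_biUnion (x := w) ?_ hw
      have h1 : T.dist v₀ v = r + 1 := hv
      have h2 := hw.2
      change T.dist v₀ w = r
      omega

section Operator

variable (v₀) in
/-- The functions supported on the sphere of radius `r`. -/
def sphereSubmodule (T : SimpleGraph V) (r : ℕ) : Submodule ℂ (Ell2 V) where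
  carrier := {ξ | ∀ v, T.dist v₀ v ≠ r → ξ v = 0}
  add_mem' := by
    intro ξ η hξ hη v hv
    simp [hξ v hv, hη v hv]
  zero_mem' := fun _ _ => rfl
  smul_mem' := by
    intro c ξ hξ v hv
    simp [hξ v hv]

theorem dirac_mem_sphereSubmodule (v : V) : dirac v ∈ sphereSubmodule v₀ T (T.dist v₀ v) := by
  intro u hu
  refine dirac_of_ne ?_
  rintro rfl
  exact hu rfl

variable (v₀) in
/-- The operator `ξ ↦ ξ ∘ parent`. -/
noncomputable def raising (h : BoundedDegree T) : Ell2 V →L[ℂ] Ell2 V :=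
  directedOperator h fun u v => T.dist v₀ u = T.dist v₀ v + 1

theorem mem_children_iff {u v : V} :
    u ∈ children T v₀ v ↔ T.Adj v u ∧ T.dist v₀ u = T.dist v₀ v + 1 :=
  Iff.rfl

theorem raising_apply (h : BoundedDegree T) (ξ : Ell2 V) (u : V) :
    raising v₀ h ξ u =
      ∑ v ∈ (h.nbrs u).filter fun v => T.dist v₀ u = T.dist v₀ v + 1, ξ v := by
  rw [raising, directedOperator_apply]
  congr!

theorem adjoint_raising_apply (h : BoundedDegree T) (ξ : Ell2 V) (v : V) :
    (raising v₀ h).adjoint ξ v =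
      ∑ w ∈ (h.nbrs v).filter fun w => T.dist v₀ w = T.dist v₀ v + 1, ξ w := by
  rw [raising, adjoint_directedOperator, directedOperator_apply]
  congr!

theorem raising_apply_of_mem_children (hT : T.IsTree) (h : BoundedDegree T) (ξ : Ell2 V) {v w : V}
    (hw : w ∈ children T v₀ v) : raising v₀ h ξ w = ξ v := by
  classical
  rw [raising_apply, Finset.sum_eq_single v]
  · intro u hu huv
    rw [Finset.mem_filter, h.mem_nbrs] at hu
    exact absurd (parent_unique hT ⟨hu.1.symm, hu.2⟩ hw) huv
  · intro hv
    exact absurd (Finset.mem_filter.2 ⟨h.mem_nbrs.2 hw.1.symm, hw.2⟩) hv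

/-- In a tree the root distances of adjacent vertices differ by exactly one, so each neighbour is
either a parent or a child. -/
theorem adjacencyOperator_eq (hT : T.IsTree) (h : BoundedDegree T) :
    adjacencyOperator T h = raising v₀ h + (raising v₀ h).adjoint := by
  classical
  ext ξ u
  rw [adjacencyOperator_apply, add_apply, lp.coeFn_add, Pi.add_apply,
    raising_apply, adjoint_raising_apply,
    ← Finset.sum_filter_add_sum_filter_not _ (fun v => T.dist v₀ u = T.dist v₀ v + 1)]
  congr 1
  refine Finset.sum_congr (Finset.filter_congr fun v hv => ?_) fun _ _ => rfl
  rcases hT.dist_eq_dist_add_one_of_adj v₀ (h.mem_nbrs.1 hv) with h1 | h1 <;> omega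

theorem adjoint_raising_dirac (hT : T.IsTree) (h : BoundedDegree T) {a v : V}
    (ha : a ∈ children T v₀ v) : (raising v₀ h).adjoint (dirac a) = dirac v := by
  classical
  rw [raising, adjoint_directedOperator]
  ext u
  rw [directedOperator_dirac_apply]
  split_ifs with hu
  · rw [parent_unique hT hu ha, dirac_same]
  · refine (dirac_of_ne ?_).symm
    rintro rfl
    exact hu ha

theorem dirac_mem_primitive (h : BoundedDegree T) :
    dirac v₀ ∈ primitive (raising v₀ h) (sphereSubmodule v₀ T) 0 := by
  classical
  have h1 := dirac_mem_sphereSubmodule (T := T) (v₀ := v₀) v₀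
  rw [SimpleGraph.dist_self] at h1
  refine mem_primitive.2 ⟨h1, ?_⟩
  rw [raising, adjoint_directedOperator]
  ext u
  rw [directedOperator_dirac_apply, if_neg]
  · rfl
  · rw [SimpleGraph.dist_self]
    omega

theorem isRaisingOperator_raising (hT : IsSphericallySymmetricTree T v₀ d) (hd : ∀ r, 2 ≤ d r)
    (h : BoundedDegree T) :
    IsRaisingOperator (raising v₀ h) (sphereSubmodule v₀ T) d := by
  classical
  refine ⟨fun r => ?_, ?_, ?_, ?_, ?_, ?_, ?_, fun r => ?_, fun r => ?_⟩
  · have := (hT.finite_sphere r).to_subtype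
    let f : sphereSubmodule v₀ T r →ₗ[ℂ] ({v | T.dist v₀ v = r} → ℂ) :=
      { toFun := fun ξ v => (ξ : Ell2 V) v
        map_add' := fun _ _ => rfl
        map_smul' := fun _ _ => rfl }
    refine Module.Finite.of_injective f fun ξ η hξη => Subtype.ext (lp.ext (funext fun v => ?_))
    by_cases hv : T.dist v₀ v = r
    · exact congrFun hξη ⟨v, hv⟩
    · rw [ξ.2 v hv, η.2 v hv]
  · intro r s hrs ξ hξ η hη
    rw [lp.inner_eq_tsum]
    refine (tsum_congr fun v => ?_).trans tsum_zero
    by_cases hv : T.dist v₀ v = r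
    · rw [hη v (hv ▸ hrs), inner_zero_right]
    · rw [hξ v hv, inner_zero_left]
  · rw [Submodule.topologicalClosure_eq_top_iff, Submodule.eq_bot_iff]
    intro ξ hξ
    ext v
    rw [← inner_dirac_left]
    exact Submodule.inner_right_of_mem_orthogonal
      (Submodule.mem_iSup_of_mem _ (dirac_mem_sphereSubmodule v)) hξ
  · intro r ξ hξ w hw
    rw [raising_apply]
    refine Finset.sum_eq_zero fun v hv => hξ v ?_
    have := (Finset.mem_filter.1 hv).2
    omega
  · intro r ξ hξ w hw
    rw [adjoint_raising_apply]
    refine Finset.sum_eq_zero fun v hv => hξ v ?_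
    have := (Finset.mem_filter.1 hv).2
    omega
  · intro ξ hξ
    ext w
    rw [adjoint_raising_apply]
    refine Finset.sum_eq_zero fun v hv => hξ v ?_
    have := (Finset.mem_filter.1 hv).2
    omega
  · intro r ξ hξ
    ext v
    rw [adjoint_raising_apply, lp.coeFn_smul, Pi.smul_apply, smul_eq_mul]
    -- `S†S ξ` at `v` sums the constant value `ξ v` over the children of `v`, so the scalar is their
    -- number.
    have hcard : ((h.nbrs v).filter fun w => T.dist v₀ w = T.dist v₀ v + 1).card
        = d (T.dist v₀ v) := by
      have h1 := hT.encard_children v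
      have h2 : children T v₀ v
          = ((h.nbrs v).filter fun w => T.dist v₀ w = T.dist v₀ v + 1 : Finset V) := by
        ext w
        rw [Finset.mem_coe, Finset.mem_filter, h.mem_nbrs, mem_children_iff]
      rw [h2, Set.encard_coe_eq_coe_finsetCard] at h1
      exact_mod_cast h1
    have hsum : ∀ w ∈ (h.nbrs v).filter fun w => T.dist v₀ w = T.dist v₀ v + 1,
        raising v₀ h ξ w = ξ v := fun w hw =>
      raising_apply_of_mem_children hT.isTree h ξ
        ⟨h.mem_nbrs.1 (Finset.mem_filter.1 hw).1, (Finset.mem_filter.1 hw).2⟩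
    rw [Finset.sum_congr rfl hsum, Finset.sum_const, hcard, nsmul_eq_mul]
    by_cases hv : T.dist v₀ v = r
    · rw [hv]
    · rw [hξ v hv, mul_zero, mul_zero]
  · have := hd r
    omega
  · cases r with
    | zero =>
      refine ⟨dirac v₀, (mem_primitive.1 (dirac_mem_primitive h)).1, fun hc => ?_,
        (mem_primitive.1 (dirac_mem_primitive h)).2⟩
      have := dirac_same v₀
      rw [hc] at this
      exact zero_ne_one this
    | succ r =>
      obtain ⟨v, hv, -⟩ := hT.exists_descendant hd v₀ r
      rw [SimpleGraph.dist_self, zero_add] at hv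
      obtain ⟨a, ha, b, hb, hab⟩ := hT.children_nonempty hd v
      have ha1 := dirac_mem_sphereSubmodule (T := T) (v₀ := v₀) a
      have hb1 := dirac_mem_sphereSubmodule (T := T) (v₀ := v₀) b
      rw [ha.2, hv] at ha1
      rw [hb.2, hv] at hb1
      -- `S†` sends both siblings to their common parent, so the difference is primitive.
      refine ⟨dirac a - dirac b, Submodule.sub_mem _ ha1 hb1, fun hc => ?_, ?_⟩
      · have := dirac_same a
        rw [sub_eq_zero.1 hc, dirac_of_ne hab] at this
        exact zero_ne_one this
      · rw [map_sub, adjoint_raising_dirac hT.isTree h ha, adjoint_raising_dirac hT.isTree h hb,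
          sub_self]

theorem isSelfAdjoint_adjacencyOperator (hT : IsSphericallySymmetricTree T v₀ d)
    (h : BoundedDegree T) : IsSelfAdjoint (adjacencyOperator T h) := by
  rw [adjacencyOperator_eq (v₀ := v₀) hT.isTree]
  exact isSelfAdjoint_add_adjoint _

/-- The moments of the local spectral measure at the root. -/
theorem moment_root (hT : IsSphericallySymmetricTree T v₀ d) (hd : ∀ r, 2 ≤ d r)
    (h : BoundedDegree T) (n : ℕ) :
    ((∫ x, x ^ n ∂(localSpectralMeasure (adjacencyOperator T h) (dirac v₀)) : ℝ) : ℂ) =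
      jacobiMoment d n 0 0 := by
  have h1 := (hT.isRaisingOperator_raising hd h).inner_orbit (dirac_mem_primitive h)
    (dirac_mem_primitive h) 0 n
  rw [← moment_localSpectralMeasure (hT.isSelfAdjoint_adjacencyOperator h),
    adjacencyOperator_eq (v₀ := v₀) hT.isTree]
  rw [inner_dirac_left v₀ (dirac v₀), dirac_same, mul_one, zero_add] at h1
  simpa only [zero_add, pow_zero, one_apply_eq_self] using h1

end Operator

end IsSphericallySymmetricTree

/-! ### Isomorphisms and degrees -/

section Iso

variable {V W : Type*} {G : SimpleGraph V} {G' : SimpleGraph W}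

theorem dist_map_le (hG : G.Connected) (φ : G →g G') (u v : V) :
    G'.dist (φ u) (φ v) ≤ G.dist u v := by
  obtain ⟨p, hp⟩ := hG.exists_walk_length_eq_dist u v
  rw [← hp, ← SimpleGraph.Walk.length_map φ p]
  exact SimpleGraph.dist_le _

theorem dist_iso (hG : G.Connected) (φ : G ≃g G') (u v : V) :
    G'.dist (φ u) (φ v) = G.dist u v := by
  refine le_antisymm (dist_map_le hG φ.toHom u v) ?_
  have := dist_map_le (φ.connected_iff.1 hG) φ.symm.toHom (φ u) (φ v)
  simpa using this

theorem encard_neighborSet_iso (φ : G ≃g G') (v : V) :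
    (G'.neighborSet (φ v)).encard = (G.neighborSet v).encard :=
  (Set.encard_congr (φ.mapNeighborSet v)).symm

end Iso

namespace IsSphericallySymmetricTree

variable {V W : Type*} {T : SimpleGraph V} {T' : SimpleGraph W} {v₀ : V} {w₀ : W} {d d' : ℕ → ℕ}

/-- If the branching degrees are periodic with a common period, isomorphisms preserve the root. -/
theorem map_root (hT : IsSphericallySymmetricTree T v₀ d)
    (hT' : IsSphericallySymmetricTree T' w₀ d')
    (hd' : ∀ r, 2 ≤ d' r) {p : ℕ} (hp : 1 ≤ p) (hper : ∀ r, d (p + r) = d r)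
    (hper' : ∀ r, d' (p + r) = d' r) (φ : T ≃g T') : φ v₀ = w₀ := by
  by_contra hne
  -- By periodicity `w` has the degree of `φ v₀`, which is `d 0`; but its preimage lies at distance
  -- `p` from `v₀` and has degree `d p + 1 = d 0 + 1`.
  obtain ⟨w, hw1, hw2⟩ := hT'.exists_descendant hd' (φ v₀) p
  have hw : w ≠ w₀ := by
    rintro rfl
    rw [SimpleGraph.dist_self] at hw1
    omega
  have h1 := encard_neighborSet_iso φ v₀
  rw [hT'.encard_neighborSet hne, hT.encard_neighborSet_root] at h1
  have hdist : T.dist v₀ (φ.symm w) = p := by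
    rw [← dist_iso hT.isTree.connected φ, φ.apply_symm_apply, hw2]
  have hne' : φ.symm w ≠ v₀ := by
    intro hc
    rw [hc, SimpleGraph.dist_self] at hdist
    omega
  have h2 := encard_neighborSet_iso φ (φ.symm w)
  rw [hT.encard_neighborSet hne', φ.apply_symm_apply, hT'.encard_neighborSet hw, hw1, hdist,
    add_comm _ p, hper', h1, ← add_zero p, hper] at h2
  norm_cast at h2
  omega

/-- Isomorphic trees with periodic branching degrees have the same branching degrees. -/
theorem eq_of_iso (hT : IsSphericallySymmetricTree T v₀ d)
    (hT' : IsSphericallySymmetricTree T' w₀ d')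
    (hd : ∀ r, 2 ≤ d r) (hd' : ∀ r, 2 ≤ d' r) {p : ℕ} (hp : 1 ≤ p) (hper : ∀ r, d (p + r) = d r)
    (hper' : ∀ r, d' (p + r) = d' r) (φ : T ≃g T') (n : ℕ) : d n = d' n := by
  have h0 := hT.map_root hT' hd' hp hper hper' φ
  cases n with
  | zero =>
    have h1 := encard_neighborSet_iso φ v₀
    rw [h0, hT.encard_neighborSet_root, hT'.encard_neighborSet_root] at h1
    exact_mod_cast h1.symm
  | succ n =>
    obtain ⟨v, hv, -⟩ := hT.exists_descendant hd v₀ (n + 1)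
    rw [SimpleGraph.dist_self, zero_add] at hv
    have hv' : T'.dist w₀ (φ v) = n + 1 := by
      rw [← h0, dist_iso hT.isTree.connected, hv]
    have hne : v ≠ v₀ := by
      rintro rfl
      rw [SimpleGraph.dist_self] at hv
      omega
    have hne' : φ v ≠ w₀ := fun hc => hne (φ.injective (hc.trans h0.symm))
    have h1 := encard_neighborSet_iso φ v
    rw [hT.encard_neighborSet hne, hT'.encard_neighborSet hne', hv, hv'] at h1
    norm_cast at h1
    omega

/-- The adjacency operator of a tree with periodic branching degrees is an infinite multiple of
the direct sum of the tridiagonal operators attached to the shifts of the branching degrees. -/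
theorem exists_unitary (hT : IsSphericallySymmetricTree T v₀ d) (hd : ∀ r, 2 ≤ d r)
    (h : BoundedDegree T) {κ : Type*} [Fintype κ] {ν : κ → Measure ℝ} [∀ k, IsFiniteMeasure (ν k)]
    (hb : ∀ k, BoundedSupport (ν k)) (t : ℕ → κ) (ht : ∀ k, {r | t r = k}.Infinite)
    (hν : ∀ r n, ((∫ x, x ^ n ∂(ν (t r)) : ℝ) : ℂ) = jacobiMoment (fun k => d (r + k)) n 0 0) :
    ∃ U : Ell2 V ≃ₗᵢ[ℂ] Lp (Ell2 ℕ) 2 (∑ k, ν k), ∀ η : Ell2 V,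
      U (adjacencyOperator T h η) =ᵐ[∑ k, ν k] fun x => (x : ℂ) • U η x := by
  obtain ⟨ξ, lev, hsurj, hgram, htot⟩ :=
    (hT.isRaisingOperator_raising hd h).exists_cyclic_decomposition
  rw [adjacencyOperator_eq hT.isTree h]
  refine exists_unitary_multiplication hb (t := t ∘ lev) (fun k => ?_) _ ξ (fun i j m n => ?_) htot
  -- Every level occurs among the cyclic vectors, so infinitely many levels of type `k` give
  -- infinitely many summands.
  · exact (ht k).preimage (f := lev) (by rw [hsurj.range_eq]; exact Set.subset_univ _)
  · rw [hgram, Function.comp_apply, hν]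

end IsSphericallySymmetricTree

theorem add_mul_of_periodic {p : ℕ} {d : ℕ → ℕ} (hper : ∀ r, d (p + r) = d r) (m r : ℕ) :
    d (r + p * m) = d r := by
  induction m with
  | zero => simp
  | succ m ih => rw [← ih, ← hper (r + p * m), mul_add, mul_one]; congr 1; omega

end SpectralGraph

theorem mainTheorem12 (p : ℕ) (hp : 1 ≤ p) (d : ℕ → ℕ) (hd : ∀ r, 2 ≤ d r)
    (hper : ∀ r, d (p + r) = d r) {V : Fin p → Type*} (T : ∀ s, SimpleGraph (V s))
    (root : ∀ s, V s)
    (hT : ∀ s : Fin p, SpectralGraph.IsSphericallySymmetricTree (T s) (root s)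
      (fun r => d ((s : ℕ) + r))) :
    (∀ s t : Fin p, SpectralGraph.Cospectral (T s) (T t)) ∧
    ((∀ q : ℕ, 1 ≤ q → (∀ r, d (q + r) = d r) → p ≤ q) →
      ∀ s t : Fin p, s ≠ t → IsEmpty (T s ≃g T t)) := by
  have hmod (r : ℕ) : d r = d (r % p) := by
    conv_lhs => rw [← Nat.mod_add_div r p]
    exact SpectralGraph.add_mul_of_periodic hper _ _
  have hpers (s r : ℕ) : d (s + (p + r)) = d (s + r) := by
    rw [← hper (s + r)]
    congr 1
    omega
  constructor
  · have hbd : ∀ r, d r ≤ ∑ k ∈ Finset.range p, d k := fun r => by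
      rw [hmod]
      exact Finset.single_le_sum (f := d) (fun _ _ => Nat.zero_le _)
        (Finset.mem_range.2 (Nat.mod_lt r hp))
    have hB (s : Fin p) : SpectralGraph.BoundedDegree (T s) :=
      (hT s).boundedDegree fun _ => hbd _
    -- The roots of the given trees supply measures whose moments are those of the shifted
    -- sequences.
    let ν (k : Fin p) : Measure ℝ :=
      SpectralGraph.localSpectralMeasure (SpectralGraph.adjacencyOperator (T k) (hB k))
        (SpectralGraph.dirac (root k))
    have hνb (k : Fin p) : SpectralGraph.BoundedSupport (ν k) :=
      SpectralGraph.boundedSupport_localSpectralMeasure _ _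
    have hU (s : Fin p) := (hT s).exists_unitary (fun r => hd _) (hB s) hνb
      (fun r => ⟨(s + r) % p, Nat.mod_lt _ hp⟩) (fun k => by
        -- Levels `r` with `s + r ≡ k` modulo `p`; the summand `p * s` keeps the natural subtraction
        -- from truncating.
        refine Set.infinite_of_injective_forall_mem (f := fun m : ℕ => (k : ℕ) + p * (m + s) - s)
          (fun m n hmn => ?_) fun m => ?_
        · have h1 : (s : ℕ) ≤ p * (m + s) := by nlinarith
          have h2 : (s : ℕ) ≤ p * (n + s) := by nlinarith
          have h3 : p * (m + s) = p * (n + s) := by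
            dsimp only at hmn
            omega
          exact Nat.add_right_cancel (Nat.eq_of_mul_eq_mul_left hp h3)
        · refine Fin.ext ?_
          have h1 : (s : ℕ) ≤ p * (m + s) := by nlinarith
          change (s + (k + p * (m + s) - s)) % p = (k : ℕ)
          rw [Nat.add_sub_cancel' (h1.trans (Nat.le_add_left _ _)), Nat.add_mul_mod_self_left,
            Nat.mod_eq_of_lt k.2])
      (fun r n => by
        rw [(hT _).moment_root (fun r => hd _)]
        congr 1
        ext k
        change d ((s + r) % p + k) = d (s + (r + k))
        rw [← add_assoc, hmod (s + r + k), hmod, Nat.mod_add_mod])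
    intro s t
    exact ⟨hB s, hB t, SpectralGraph.sameMarkedSpectrum_of_unitary
      ((hT s).isSelfAdjoint_adjacencyOperator _) ((hT t).isSelfAdjoint_adjacencyOperator _)
      (SpectralGraph.BoundedSupport.sum _ hνb) (hU s) (hU t)⟩
  · intro hmin
    have hlt (s t : Fin p) (hst : s < t) (hall : ∀ n, d (s + n) = d (t + n)) : False := by
      have h1 : p ≤ (t : ℕ) - s := by
        refine hmin _ (by have : (s : ℕ) < t := hst; omega) fun r => ?_
        have hsp : (s : ℕ) ≤ p * s := Nat.le_mul_of_pos_left _ hp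
        have hst' : (s : ℕ) < t := hst
        -- Equality of the shifts only concerns indices from `s` on, so both sides are first moved
        -- up by `p * s ≥ s`.
        rw [← SpectralGraph.add_mul_of_periodic hper s r,
          ← SpectralGraph.add_mul_of_periodic hper s (t - s + r)]
        have e1 : r + p * s = s + (r + p * s - s) := by omega
        have e2 : (t : ℕ) - s + r + p * s = t + (r + p * s - s) := by omega
        rw [e2, ← hall, ← e1]
      have := t.2
      omega
    intro s t hst
    refine ⟨fun φ => ?_⟩
    have hall := (hT s).eq_of_iso (hT t) (fun _ => hd _) (fun _ => hd _) hp (hpers s) (hpers t) φ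
    rcases lt_or_gt_of_ne hst with h | h
    · exact hlt s t h hall
    · exact hlt t s h fun n => (hall n).symm
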